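/- Conventions. Algorithms are deterministic multi-tape (multi-stack) Turing machines, and numbers in inputs are written in binary. For $q\ge 3$ let $\delta_q$ be the infimum of the constants $c\ge 0$ for which some algorithm decides $q$-SAT (satisfiability of CNF formulas with at most $q$ literals per clause) with $n$ variables and $m$ clauses in time $2^{cn}\cdot m^{O(1)}$. The Strong Exponential-Time Hypothesis (SETH) states that $\lim_{q\to\infty}\delta_q=1$. The problem (IP) with a non-negative constraint matrix asks, for a non-negative integer matrix $A\in\mathbb Z_{\ge 0}^{m\times n}$ and a vector $b\in\mathbb Z_{\ge 0}^{m}$, whether there is $x\in\mathbb Z_{\ge 0}^n$ with $Ax=b$; $|I|$ denotes the length of the encoding of the instance $I=(A,b)$, so that $|I|\ge mn$. For a matroid $M$ on a finite set $U$ with rank function $r$, let $\lambda_M(X)=r(X)+r(U\setminus X)-r(U)+1$. The path-width of $M$ is the minimum, over all cubic caterpillars $T$ (trees all of whose internal vertices have degree $3$, obtained from a path by attaching leaves to some of its vertices) and all bijections from $U$ to the leaves of $T$, of the maximum over the edges $e$ of $T$ of $\lambda_M(X_e)$, where $X_e\subseteq U$ is the set of elements whose leaves lie in one of the two components of $T-e$.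 Theorem. Assume SETH. Then, for every function $f$, every $\varepsilon>0$ and every constant $a$, there is no algorithm that decides every instance $I=(A,b)$ of (IP) with a non-negative $m\times n$ constraint matrix $A$ in time $$f(d)\,(d+1)^{(1-\varepsilon)k}\,|I|^{a},$$ where $d=\max\{b_1,\dots,b_m\}$ and $k$ is the path-width of the column matroid of $A$ (over $\mathbb R$). In particular, since $|I|\ge mn$, there is no such algorithm with running time $f(d)(d+1)^{(1-\varepsilon)k}(mn)^{O(1)}$. -/

import Mathlib

open scoped NNReal ENNReal

/-! ### Machines and running time

Algorithms are deterministic multi-stack (equivalently, multi-tape) Turing machines: Mathlib's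
`Turing.FinTM2`, here with input alphabet `Computability.Γ'` (bits, brackets, comma, blank) and
Boolean output. Time is the number of machine steps. -/

/-- On the input word `w`, the machine `M` halts after at most `t` steps, and its output is the
truth value of `P`. -/
def DecidesWithin (M : Turing.TM2ComputableAux Computability.Γ' Bool)
    (w : List Computability.Γ') (P : Prop) (t : ℝ) : Prop :=
  open scoped Classical in
  ∃ s : ℕ, (s : ℝ) ≤ t ∧
    Nonempty (Turing.TM2OutputsInTime M.tm (w.map M.inputAlphabet.invFun)
      (some ((Computability.encodeBool (decide P)).map M.outputAlphabet.invFun)) s)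

/-- A natural number in binary, terminated by a comma. -/
def encodeNumber (x : ℕ) : List Computability.Γ' :=
  (Computability.encodeNat x).map Computability.Γ'.bit ++ [Computability.Γ'.comma]

/-! ### Satisfiability and the Strong Exponential-Time Hypothesis -/

/-- CNF formulas over the variables `0, …, n - 1`: lists of clauses, a clause being a list of
literals. The literal `(x, true)` is the variable `x`, and `(x, false)` is its negation. -/
abbrev CNFFormula (n : ℕ) : Type := List (List (Fin n × Bool))

namespace CNFFormula

/-- Some assignment makes at least one literal of every clause true. -/
def Satisfiable {n : ℕ} (φ : CNFFormula n) : Prop :=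
  ∃ v : Fin n → Bool, ∀ C ∈ φ, ∃ l ∈ C, v l.1 = l.2

/-- Every clause has at most `q` literals. -/
def IsWidthLE {n : ℕ} (φ : CNFFormula n) (q : ℕ) : Prop :=
  ∀ C ∈ φ, C.length ≤ q

/-- The number of variables, and then each clause in brackets; a literal is its sign bit followed
by the index of its variable in binary. -/
def encode {n : ℕ} (φ : CNFFormula n) : List Computability.Γ' :=
  encodeNumber n ++ φ.flatMap fun C =>
    [Computability.Γ'.bra] ++
      C.flatMap (fun l => Computability.Γ'.bit l.2 :: encodeNumber (l.1 : ℕ)) ++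
      [Computability.Γ'.ket]

end CNFFormula

/-- Some algorithm solves `q`-SAT with `n` variables and `m` clauses in time
`2 ^ (c * n) * m ^ O(1)` (with `m + 1` in place of `m`, to allow for the empty formula). -/
def QSatSolvableWithExponent (q : ℕ) (c : ℝ≥0) : Prop :=
  ∃ (M : Turing.TM2ComputableAux Computability.Γ' Bool) (K a : ℕ),
    ∀ (n : ℕ) (φ : CNFFormula n), φ.IsWidthLE q →
      DecidesWithin M φ.encode φ.Satisfiable
        ((K : ℝ) * (2 : ℝ) ^ ((c : ℝ) * (n : ℝ)) * ((φ.length : ℝ) + 1) ^ a)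

/-- The infimum `δ_q` of the exponents `c` such that `q`-SAT is solvable in time
`2 ^ (c * n) * m ^ O(1)`. -/
noncomputable def satExponent (q : ℕ) : ℝ≥0∞ :=
  ⨅ (c : ℝ≥0) (_ : QSatSolvableWithExponent q c), (c : ℝ≥0∞)

/-- The Strong Exponential-Time Hypothesis: `δ_q` tends to `1` as `q` tends to infinity. -/
def SETH : Prop :=
  Filter.Tendsto satExponent Filter.atTop (nhds 1)

/-! ### Path-width of matroids -/

namespace Matroid

variable {α : Type*}

/-- The connectivity function `r(X) + r(E \ X) - r(E) + 1` of a (finite) matroid. -/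
noncomputable def connectivity (M : Matroid α) (X : Set α) : ℕ :=
  (M.eRk X).toNat + (M.eRk (M.E \ X)).toNat - (M.eRk M.E).toNat + 1

/-- A branch decomposition of a matroid: a finite tree all of whose internal vertices have
degree `3`, and a bijection from the elements of the matroid to the leaves of the tree.
The vertex of a one-vertex tree counts as a leaf. -/
structure BranchDecomposition (M : Matroid α) where
  /-- The vertices of the tree. -/
  V : Type
  finite_V : Finite V
  /-- The tree. -/
  T : SimpleGraph V
  isTree : T.IsTree
  cubic : ∀ v : V, (T.neighborSet v).ncard ≤ 1 ∨ (T.neighborSet v).ncard = 3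
  /-- The bijection to the leaves. -/
  leaf : M.E ≃ {v : V // (T.neighborSet v).ncard ≤ 1}

namespace BranchDecomposition

variable {M : Matroid α}

/-- The elements whose leaves lie in the same component as `u` after the edge between `u` and `v`
is deleted. -/
def side (D : M.BranchDecomposition) (u v : D.V) : Set α :=
  {x | ∃ hx : x ∈ M.E, (D.T.deleteEdges {s(u, v)}).Reachable u (D.leaf ⟨x, hx⟩)}

/-- Every edge of the tree has width at most `w`. -/
def WidthLE (D : M.BranchDecomposition) (w : ℕ) : Prop :=
  ∀ u v : D.V, D.T.Adj u v → M.connectivity (D.side u v) ≤ w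

/-- The tree is a caterpillar: it has a path such that every vertex outside of the path is a leaf
attached to a vertex of the path. -/
def IsCaterpillar (D : M.BranchDecomposition) : Prop :=
  ∃ (u v : D.V) (p : D.T.Walk u v), p.IsPath ∧
    ∀ y : D.V, y ∉ p.support → ∃ x ∈ p.support, D.T.neighborSet y = {x}

end BranchDecomposition

/-- The path-width of a finite matroid: the least width of a branch decomposition whose tree is a
caterpillar (`0` for a matroid with at most one element). -/
noncomputable def pathWidth (M : Matroid α) : ℕ :=
  sInf {w : ℕ | ∃ D : M.BranchDecomposition, D.IsCaterpillar ∧ D.WidthLE w}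

end Matroid

/-- The column matroid of a real matrix: its elements are (the indices of) the columns, and the
independent sets are the linearly independent sets of columns. -/
noncomputable def Matrix.columnMatroid {ι κ : Type*} [Finite κ] (A : Matrix ι κ ℝ) : Matroid κ :=
  (IndepMatroid.ofFinite (E := (Set.univ : Set κ)) Set.finite_univ
    (fun I => LinearIndepOn ℝ A.col I)
    (linearIndepOn_empty ℝ A.col)
    (fun _ _ hJ hIJ => hJ.mono hIJ)
    (by
      intro I J hI hJ hlt
      by_contra! hcon
      have hsub : A.col '' J ⊆ Submodule.span ℝ (A.col '' I) := by
        rintro _ ⟨e, he, rfl⟩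
        by_cases heI : e ∈ I
        · exact Submodule.subset_span ⟨e, heI, rfl⟩
        · by_contra hspan
          exact hcon e he heI (hI.insert hspan)
      have hfin : (A.col '' I).Finite := Set.toFinite _
      have : FiniteDimensional ℝ (Submodule.span ℝ (A.col '' I)) :=
        FiniteDimensional.span_of_finite ℝ hfin
      have hle := Submodule.finrank_mono (Submodule.span_le.2 hsub)
      have card : ∀ S : Set κ, LinearIndepOn ℝ A.col S →
          Module.finrank ℝ (Submodule.span ℝ (A.col '' S)) = S.ncard := by
        intro S hS
        have := Fintype.ofFinite S
        rw [Set.image_eq_range, finrank_span_eq_card hS, ← Nat.card_eq_fintype_card,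
          Nat.card_coe_set_eq]
      rw [card I hI, card J hJ] at hle
      omega)
    (fun _ _ => Set.subset_univ _)).matroid

/-! ### Integer programming -/

/-- An instance of (IP) with non-negative data: an `m × n` matrix `A` and an `m`-vector `b` of
non-negative integers. -/
structure IPInstance where
  /-- The number of constraints. -/
  m : ℕ
  /-- The number of variables. -/
  n : ℕ
  /-- The constraint matrix. -/
  A : Matrix (Fin m) (Fin n) ℕ
  /-- The target vector. -/
  b : Fin m → ℕ

namespace IPInstance

/-- There is a non-negative integer vector `x` with `A x = b`. -/
def Feasible (P : IPInstance) : Prop :=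
  ∃ x : Fin P.n → ℕ, P.A.mulVec x = P.b

/-- The largest entry of `b` (`0` if there are no constraints). -/
def maxTarget (P : IPInstance) : ℕ :=
  Finset.univ.sup P.b

/-- The path-width of the column matroid of `A`. -/
noncomputable def pathWidth (P : IPInstance) : ℕ :=
  (P.A.map (fun x : ℕ => (x : ℝ))).columnMatroid.pathWidth

/-- The numbers `m` and `n`, the rows of `A`, each in brackets, and then `b` in brackets; all
numbers are in binary. -/
def encode (P : IPInstance) : List Computability.Γ' :=
  encodeNumber P.m ++ encodeNumber P.n ++
    (List.finRange P.m).flatMap (fun i =>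
      [Computability.Γ'.bra] ++ (List.finRange P.n).flatMap (fun j => encodeNumber (P.A i j)) ++
        [Computability.Γ'.ket]) ++
    [Computability.Γ'.bra] ++ (List.finRange P.m).flatMap (fun i => encodeNumber (P.b i)) ++
      [Computability.Γ'.ket]

/-- The length of the encoding. Every entry of `A` contributes at least one symbol, so this is at
least `m * n`. -/
def size (P : IPInstance) : ℕ := P.encode.length

end IPInstance

/-- Some algorithm solves every instance `P` of (IP) with non-negative data in time at
most `t P`. -/
def IPSolvableInTime (t : IPInstance → ℝ) : Prop :=
  ∃ M : Turing.TM2ComputableAux Computability.Γ' Bool,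
    ∀ P : IPInstance, DecidesWithin M P.encode P.Feasible (t P)

/-! A CNF formula with `n` variables and `m` clauses is turned, in polynomial time, into a 0/1
system with right-hand side `1, …, 1` whose column matroid has path-width at most `n + 3`. Then `d ≤
1`, so `f(d)` is bounded by a constant, and for `ε ≤ 1` the factor `(d + 1)^((1 - ε) k)` is at most
a constant times `2^((1 - ε) n)`. An algorithm for (IP) with the stated running time would thus
solve `q`-SAT for all `q` with one common exponent `c < 1`. Hence `δ_q ≤ c` for all `q`, against
`δ_q → 1`.

The columns come in `2nm + n` groups of two; let `y h` be the sum of the variables of group `h`. The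
chain rows say `y g + y (g + n) = 1` for `g < 2nm`. So `y` is 0/1-valued on the groups they meet and
has period `2n`, and every block of `2n` groups repeats the truth values of the `2n` literals, the
negative ones first. The row of clause `k` adds up the second columns of those groups in block `k`
that belong to literals of the clause. A nonzero term of this sum makes its literal true.
Conversely, a satisfying assignment allows choosing one true literal per clause; the first columns
are slack that carries the other true literals. This is `feasible_satInstance`.

For the path-width the columns are kept in their order along a caterpillar. A cut is crossed by at
most `n + 1` chain rows, and by at most one clause row because the clauses use disjoint blocks. The
connectivity minus one is the dimension of the intersection of the spans of the two sides, whose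
vectors vanish in every row that does not cross (`Matrix.connectivity_columnMatroid_le`,
`pathWidth_satInstance`).

The reduction itself must be a machine. It is written in a small structured language whose runs are
simulated step for step by machine code (`Exec.stepsTo_code`) and which can be put in front of any
machine (`decidesWithin_precompose`). The program is analysed in `runs_reduction`, and
`encode_satInstance` identifies its output. The estimates are collected in
`qSatSolvable_of_ipSolvable`. -/

/-! ### A structured language for stack machines -/

/-- Structured programs over the stacks `K` with alphabet `A`. -/
inductive StackProg (K A : Type) : Type
  | skip : StackProg K A
  | push : K → A → StackProg K A
  | pop : K → (Option A → StackProg K A) → StackProg K A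
  | seq : StackProg K A → StackProg K A → StackProg K A
  | loop : K → (Option A → Bool) → (Option A → StackProg K A) → StackProg K A

namespace StackProg

variable {K A : Type}

/-- `p.Exec S S' t`: started on the stacks `S`, the program `p` stops with the stacks `S'` after
exactly `t` steps. A loop pops a symbol, stops if the test fails on it, and otherwise runs the body
that belongs to this symbol and starts again. -/
inductive Exec [DecidableEq K] :
    StackProg K A → (K → List A) → (K → List A) → ℕ → Prop
  | skip (S : K → List A) : Exec skip S S 1
  | push (k : K) (a : A) (S : K → List A) :
      Exec (push k a) S (Function.update S k (a :: S k)) 1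
  | pop {k : K} {f : Option A → StackProg K A} {S S' : K → List A} {t : ℕ} :
      Exec (f (S k).head?) (Function.update S k (S k).tail) S' t → Exec (pop k f) S S' (t + 1)
  | seq {p q : StackProg K A} {S S' S'' : K → List A} {t t' : ℕ} :
      Exec p S S' t → Exec q S' S'' t' → Exec (seq p q) S S'' (t + t')
  | loop_exit {k : K} {c : Option A → Bool} {f : Option A → StackProg K A} {S : K → List A} :
      c (S k).head? = false → Exec (loop k c f) S (Function.update S k (S k).tail) 1
  | loop_step {k : K} {c : Option A → Bool} {f : Option A → StackProg K A}
      {S S' S'' : K → List A} {t t' : ℕ} :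
      c (S k).head? = true → Exec (f (S k).head?) (Function.update S k (S k).tail) S' t →
      Exec (loop k c f) S' S'' t' → Exec (loop k c f) S S'' (1 + t + t')

/-- The program points of a program. -/
def Label : StackProg K A → Type
  | skip => Unit
  | push _ _ => Unit
  | pop _ f => Unit ⊕ Σ o, Label (f o)
  | seq p q => Label p ⊕ Label q
  | loop _ _ f => Unit ⊕ Σ o, Label (f o)

/-- There are finitely many program points. -/
@[reducible] def labelFintype [Fintype A] : (p : StackProg K A) → Fintype p.Label
  | skip => inferInstanceAs (Fintype Unit)
  | push _ _ => inferInstanceAs (Fintype Unit)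
  | pop _ f =>
    haveI := fun o => labelFintype (f o)
    inferInstanceAs (Fintype (Unit ⊕ Σ o, Label (f o)))
  | seq p q =>
    haveI := labelFintype p
    haveI := labelFintype q
    inferInstanceAs (Fintype (Label p ⊕ Label q))
  | loop _ _ f =>
    haveI := fun o => labelFintype (f o)
    inferInstanceAs (Fintype (Unit ⊕ Σ o, Label (f o)))

/-- The first program point. -/
def start : (p : StackProg K A) → p.Label
  | skip => ()
  | push _ _ => ()
  | pop _ _ => .inl ()
  | seq p _ => .inl (start p)
  | loop _ _ _ => .inl ()

/-! ### Compilation of programs to machine code -/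

section Compile

open Turing

/-- The stack alphabets of a program that runs beside a machine. -/
abbrev JoinAlphabet (K A : Type) {K' : Type} (G : K' → Type) : K ⊕ K' → Type :=
  Sum.elim (fun _ => A) G

variable {K' : Type} {G : K' → Type} {τ Λ : Type}

/-- The machine code of a program. -/
def code : (p : StackProg K A) → (exit : Λ) → (e : p.Label → Λ) → p.Label →
    TM2.Stmt (JoinAlphabet K A G) Λ (Option A × τ)
  | skip, exit, _, _ => .goto fun _ => exit
  | push k a, exit, _, _ => .push (Sum.inl k) (fun _ => a) (.goto fun _ => exit)
  | pop k f, _, e, .inl _ =>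
    .pop (Sum.inl k) (fun s o => (o, s.2)) (.goto fun s => e (.inr ⟨s.1, (f s.1).start⟩))
  | pop _ f, exit, e, .inr ⟨o, l⟩ => code (f o) exit (fun l => e (.inr ⟨o, l⟩)) l
  | seq p q, _, e, .inl l => code p (e (.inr q.start)) (fun l => e (.inl l)) l
  | seq _ q, exit, e, .inr l => code q exit (fun l => e (.inr l)) l
  | loop k c f, exit, e, .inl _ =>
    .pop (Sum.inl k) (fun s o => (o, s.2))
      (.branch (fun s => c s.1) (.goto fun s => e (.inr ⟨s.1, (f s.1).start⟩))
        (.goto fun _ => exit))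
  | loop _ _ f, _, e, .inr ⟨o, l⟩ => code (f o) (e (.inl ())) (fun l => e (.inr ⟨o, l⟩)) l

/-- The stacks of a program beside those of a machine. -/
def joinStk (S : K → List A) (U : ∀ k, List (G k)) : ∀ k, List (JoinAlphabet K A G k)
  | .inl k => S k
  | .inr k => U k

variable [DecidableEq K] [DecidableEq K']

theorem update_joinStk_inl (S : K → List A) (U : ∀ k, List (G k)) (k : K) (l : List A) :
    Function.update (joinStk S U) (Sum.inl k) l = joinStk (Function.update S k l) U := by
  funext i
  rcases i with i | i
  · by_cases h : i = k
    · subst h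
      exact (Function.update_self _ _ _).trans (Function.update_self i l S).symm
    · have h' : Function.update S k l i = S i := Function.update_of_ne h l S
      exact (Function.update_of_ne (fun h' => h (Sum.inl.inj h')) _ _).trans h'.symm
  · exact Function.update_of_ne Sum.inr_ne_inl _ _

theorem update_joinStk_inr (S : K → List A) (U : ∀ k, List (G k)) (k : K') (l : List (G k)) :
    Function.update (joinStk S U) (Sum.inr k) l = joinStk S (Function.update U k l) := by
  funext i
  rcases i with i | i
  · exact Function.update_of_ne Sum.inl_ne_inr _ _
  · by_cases h : i = k
    · subst h
      exact (Function.update_self _ _ _).trans (Function.update_self i l U).symm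
    · have h' : Function.update U k l i = U i := Function.update_of_ne h l U
      exact (Function.update_of_ne (fun h' => h (Sum.inr.inj h')) _ _).trans h'.symm

end Compile

end StackProg

/-- `f` leads from `a` to `b` in exactly `t` steps. -/
def StepsTo {σ : Type*} (f : σ → Option σ) (t : ℕ) (a b : σ) : Prop :=
  (flip bind f)^[t] (some a) = some b

theorem StepsTo.single {σ : Type*} {f : σ → Option σ} {a b : σ} (h : f a = some b) :
    StepsTo f 1 a b := h

theorem StepsTo.trans {σ : Type*} {f : σ → Option σ} {s t : ℕ} {a b c : σ}
    (h₁ : StepsTo f s a b) (h₂ : StepsTo f t b c) : StepsTo f (s + t) a c := by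
  unfold StepsTo at *
  rw [Nat.add_comm, Function.iterate_add_apply, h₁, h₂]

namespace StackProg

open Turing

variable {K A : Type} {K' : Type} {G : K' → Type} {τ Λ : Type} [DecidableEq K] [DecidableEq K']

/-- Every program point is one machine statement, so the two step counts agree exactly. The exit
label and the embedding `e` of program points are arbitrary, because a subprogram continues inside
the program that contains it. The final register content `o'` is irrelevant: the register is only
read right after a pop has overwritten it. -/
theorem Exec.stepsTo_code {m : Λ → TM2.Stmt (JoinAlphabet K A G) Λ (Option A × τ)}
    {p : StackProg K A} {S S' : K → List A} {t : ℕ} (h : p.Exec S S' t) :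
    ∀ (exit : Λ) (e : p.Label → Λ), (∀ l, m (e l) = p.code exit e l) →
      ∀ (o : Option A) (v : τ) (U : ∀ k, List (G k)), ∃ o' : Option A,
        StepsTo (TM2.step m) t ⟨some (e p.start), (o, v), joinStk S U⟩
          ⟨some exit, (o', v), joinStk S' U⟩ := by
  have step_pop : ∀ (S : K → List A) (U : ∀ k, List (G k)) (k : K) (v : τ) (l l' : Λ)
      (q : TM2.Stmt (JoinAlphabet K A G) Λ (Option A × τ)) (o : Option A),
      m l = .pop (Sum.inl k) (fun s o => (o, s.2)) q →
      TM2.stepAux q ((S k).head?, v) (joinStk (Function.update S k (S k).tail) U) =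
        ⟨some l', ((S k).head?, v), joinStk (Function.update S k (S k).tail) U⟩ →
      StepsTo (TM2.step m) 1 ⟨some l, (o, v), joinStk S U⟩
        ⟨some l', ((S k).head?, v), joinStk (Function.update S k (S k).tail) U⟩ := by
    intro S U k v l l' q o hl hq
    refine StepsTo.single (congrArg some ?_)
    rw [hl, ← hq, ← update_joinStk_inl]
    rfl
  induction h with
  | skip S =>
    intro exit e he o v U
    refine ⟨o, StepsTo.single (congrArg some ?_)⟩
    rw [he]
    rfl
  | push k a S =>
    intro exit e he o v U
    refine ⟨o, StepsTo.single (congrArg some ?_)⟩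
    rw [he, ← update_joinStk_inl]
    rfl
  | @pop k f S S' t _ ih =>
    intro exit e he o v U
    obtain ⟨o', h'⟩ := ih exit (fun l => e (.inr ⟨(S k).head?, l⟩)) (fun l => he _)
      (S k).head? v U
    refine ⟨o', ?_⟩
    rw [Nat.add_comm]
    exact (step_pop S U k v _ _ _ o (he (.inl ())) rfl).trans h'
  | @seq p q S S' S'' t t' _ _ ih₁ ih₂ =>
    intro exit e he o v U
    obtain ⟨o₁, h₁⟩ := ih₁ (e (.inr q.start)) (fun l => e (.inl l)) (fun l => he _) o v U
    obtain ⟨o₂, h₂⟩ := ih₂ exit (fun l => e (.inr l)) (fun l => he _) o₁ v U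
    exact ⟨o₂, h₁.trans h₂⟩
  | @loop_exit k c f S hc =>
    intro exit e he o v U
    refine ⟨(S k).head?, step_pop S U k v _ _ _ o (he (.inl ())) ?_⟩
    simp only [TM2.stepAux, hc, cond_false]
  | @loop_step k c f S S' S'' t t' hc _ _ ih₁ ih₂ =>
    intro exit e he o v U
    obtain ⟨o₁, h₁⟩ := ih₁ (e (.inl ())) (fun l => e (.inr ⟨(S k).head?, l⟩)) (fun l => he _)
      (S k).head? v U
    obtain ⟨o₂, h₂⟩ := ih₂ exit e he o₁ v U
    refine ⟨o₂, ((step_pop S U k v _ _ _ o (he (.inl ())) ?_).trans h₁).trans h₂⟩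
    simp only [TM2.stepAux, hc, cond_true]

/-! ### A machine running beside idle stacks -/

/-- The statement of a machine, run beside the stacks of a program. -/
def embedStmt (K A L : Type) {K' : Type} {G : K' → Type} {τ Λ : Type} :
    TM2.Stmt G Λ τ → TM2.Stmt (JoinAlphabet K A G) (L ⊕ Λ) (Option A × τ)
  | .push k f q => .push (Sum.inr k) (fun s => f s.2) (embedStmt K A L q)
  | .peek k f q => .peek (Sum.inr k) (fun s o => (s.1, f s.2 o)) (embedStmt K A L q)
  | .pop k f q => .pop (Sum.inr k) (fun s o => (s.1, f s.2 o)) (embedStmt K A L q)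
  | .load f q => .load (fun s => (s.1, f s.2)) (embedStmt K A L q)
  | .branch f q₁ q₂ => .branch (fun s => f s.2) (embedStmt K A L q₁) (embedStmt K A L q₂)
  | .goto f => .goto fun s => .inr (f s.2)
  | .halt => .halt

/-- A configuration of a machine, beside a program whose stacks are `S`. -/
def embedCfg (L : Type) {K' : Type} {G : K' → Type} {τ Λ : Type} (o : Option A) (S : K → List A)
    (c : TM2.Cfg G Λ τ) : TM2.Cfg (JoinAlphabet K A G) (L ⊕ Λ) (Option A × τ) :=
  ⟨c.l.map Sum.inr, (o, c.var), joinStk S c.stk⟩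

theorem stepAux_embedStmt {L : Type} (o : Option A) (S : K → List A) (q : TM2.Stmt G Λ τ) (v : τ)
    (U : ∀ k, List (G k)) :
    TM2.stepAux (embedStmt K A L q) (o, v) (joinStk S U) =
      embedCfg L o S (TM2.stepAux q v U) := by
  induction q generalizing v U with
  | push k f q ih =>
    simp only [embedStmt, TM2.stepAux]
    rw [← ih, ← update_joinStk_inr]; rfl
  | peek k f q ih => simp only [embedStmt, TM2.stepAux]; exact ih _ _
  | pop k f q ih =>
    simp only [embedStmt, TM2.stepAux]
    rw [← ih, ← update_joinStk_inr]; rfl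
  | load f q ih => simp only [embedStmt, TM2.stepAux]; exact ih _ _
  | branch f q₁ q₂ ih₁ ih₂ =>
    simp only [embedStmt, TM2.stepAux]
    cases f v
    · exact ih₂ _ _
    · exact ih₁ _ _
  | goto f => rfl
  | halt => rfl

/-- Optional configurations let the induction pass through halting: a halted configuration steps to
`none` on both sides. -/
theorem iterate_embedCfg {L : Type} (o : Option A) (S : K → List A) {mt : Λ → TM2.Stmt G Λ τ}
    {m : L ⊕ Λ → TM2.Stmt (JoinAlphabet K A G) (L ⊕ Λ) (Option A × τ)}
    (hm : ∀ l, m (.inr l) = embedStmt K A L (mt l)) (t : ℕ) (c : Option (TM2.Cfg G Λ τ)) :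
    (flip bind (TM2.step m))^[t] (c.map (embedCfg L o S)) =
      ((flip bind (TM2.step mt))^[t] c).map (embedCfg L o S) := by
  induction t generalizing c with
  | zero => rfl
  | succ t ih =>
    rw [Function.iterate_succ_apply, Function.iterate_succ_apply, ← ih]
    congr 1
    rcases c with _ | ⟨_ | l, v, U⟩
    · rfl
    · rfl
    · change some (TM2.stepAux (m (.inr l)) (o, v) (joinStk S U)) = some _
      rw [hm, stepAux_embedStmt]

/-! ### A program in front of a machine -/

/-- The code of `precompose`. -/
def precomposeCode (p : StackProg K Computability.Γ') (out : K)
    (M : TM2ComputableAux Computability.Γ' Bool) :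
    (p.Label ⊕ Unit) ⊕ M.tm.Λ →
      TM2.Stmt (JoinAlphabet K Computability.Γ' M.tm.Γ) ((p.Label ⊕ Unit) ⊕ M.tm.Λ)
        (Option Computability.Γ' × M.tm.σ)
  | .inl (.inl l) => p.code (.inl (.inr ())) (fun l => .inl (.inl l)) l
  | .inl (.inr _) => .pop (Sum.inl out) (fun s o => (o, s.2))
      (.branch (fun s => s.1.isSome)
        (.push (Sum.inr M.tm.k₀) (fun s => M.inputAlphabet.invFun (s.1.getD .blank))
          (.goto fun _ => .inl (.inr ())))
        (.goto fun _ => .inr M.tm.main))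
  | .inr l => embedStmt K Computability.Γ' (p.Label ⊕ Unit) (M.tm.m l)

/-- The machine that runs the program `p`, moves the symbols on the stack `out` to the input stack
of `M`, and then runs `M`. -/
def precompose [Fintype K] (p : StackProg K Computability.Γ') (inp out : K)
    (M : TM2ComputableAux Computability.Γ' Bool) :
    TM2ComputableAux Computability.Γ' Bool where
  tm :=
    haveI := p.labelFintype
    haveI := M.tm.kFin
    haveI := M.tm.ΛFin
    haveI := M.tm.σFin
    { K := K ⊕ M.tm.K
      k₀ := .inl inp
      k₁ := .inr M.tm.k₁
      Γ := JoinAlphabet K Computability.Γ' M.tm.Γ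
      Λ := (p.Label ⊕ Unit) ⊕ M.tm.Λ
      main := .inl (.inl p.start)
      σ := Option Computability.Γ' × M.tm.σ
      initialState := (none, M.tm.initialState)
      Γk₀Fin := inferInstanceAs (Fintype Computability.Γ')
      m := precomposeCode p out M }
  inputAlphabet := Equiv.refl _
  outputAlphabet := M.outputAlphabet

theorem initList_eq_update (tm : FinTM2) (l : List (tm.Γ tm.k₀)) :
    initList tm l = ⟨some tm.main, tm.initialState, Function.update (fun _ => []) tm.k₀ l⟩ := by
  simp only [initList]
  congr 1
  funext k
  by_cases h : k = tm.k₀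
  · subst h; simp
  · simp [h]

theorem haltList_eq_update (tm : FinTM2) (l : List (tm.Γ tm.k₁)) :
    haltList tm l = ⟨none, tm.initialState, Function.update (fun _ => []) tm.k₁ l⟩ := by
  simp only [haltList]
  congr 1
  funext k
  by_cases h : k = tm.k₁
  · subst h; simp
  · simp [h]

/-- Moving symbols between stacks reverses the word, which is why programs leave their output
reversed. The last pop finds an empty stack and resets the register to `none`, its value in the
initial state, which the joint machine must show again when it halts. -/
theorem stepsTo_transfer (p : StackProg K Computability.Γ') (out : K)
    (M : TM2ComputableAux Computability.Γ' Bool) (x : List Computability.Γ') :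
    ∀ (S : K → List Computability.Γ') (y : List (M.tm.Γ M.tm.k₀)) (o : Option Computability.Γ'),
      S out = x →
      StepsTo (TM2.step (precomposeCode p out M)) (x.length + 1)
        ⟨some (.inl (.inr ())), (o, M.tm.initialState),
          joinStk S (Function.update (fun _ => []) M.tm.k₀ y)⟩
        (embedCfg (p.Label ⊕ Unit) none (Function.update S out [])
          (initList M.tm (x.reverse.map M.inputAlphabet.invFun ++ y))) := by
  induction x with
  | nil =>
    intro S y o hS
    refine StepsTo.single (congrArg some ?_)
    rw [initList_eq_update]
    change TM2.stepAux (.pop (Sum.inl out) _ (.branch _ _ _)) _ _ = _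
    have hj : joinStk S (Function.update (fun k => ([] : List (M.tm.Γ k))) M.tm.k₀ y)
      (Sum.inl out) = [] := hS
    simp only [TM2.stepAux, embedCfg]
    rw [hj]
    rw [← update_joinStk_inl]
    rfl
  | cons a x ih =>
    intro S y o hS
    have h := ih (Function.update S out x) (M.inputAlphabet.invFun a :: y) (some a) (by simp)
    rw [Function.update_idem] at h
    rw [List.length_cons, Nat.add_comm (x.length + 1) 1]
    rw [List.reverse_cons, List.map_append, List.append_assoc]
    refine StepsTo.trans (StepsTo.single (congrArg some ?_)) h
    change TM2.stepAux (.pop (Sum.inl out) _ (.branch _ _ _)) _ _ = _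
    have hj : joinStk S (Function.update (fun k => ([] : List (M.tm.Γ k))) M.tm.k₀ y)
      (Sum.inl out) = a :: x := hS
    simp only [TM2.stepAux]
    rw [hj]
    refine congrArg (TM2.Cfg.mk (some (Sum.inl (Sum.inr ()))) (some a, M.tm.initialState)) ?_
    have h₁ := update_joinStk_inl S (Function.update (fun k => ([] : List (M.tm.Γ k))) M.tm.k₀ y)
      out x
    have h₂ := update_joinStk_inr (Function.update S out x)
      (Function.update (fun k => ([] : List (M.tm.Γ k))) M.tm.k₀ y) M.tm.k₀
      (M.inputAlphabet.invFun a :: y)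
    rw [Function.update_idem] at h₂
    have h₀ : Function.update (fun k => ([] : List (M.tm.Γ k))) M.tm.k₀ y M.tm.k₀ = y :=
      Function.update_self _ _ _
    have h₃ : Function.update (joinStk S (Function.update (fun k => ([] : List (M.tm.Γ k)))
        M.tm.k₀ y)) (Sum.inl out) x (Sum.inr M.tm.k₀) = y :=
      (Function.update_of_ne Sum.inr_ne_inl _ _).trans h₀
    rw [← h₂, ← h₁]
    exact congrArg (fun z : List (M.tm.Γ M.tm.k₀) => Function.update
      (β := fun k => List (JoinAlphabet K Computability.Γ' M.tm.Γ k)) _ (Sum.inr M.tm.k₀)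
      (M.inputAlphabet.invFun a :: z)) h₃

/-- The run consists of the program, the transfer and the run of `M`. A halting configuration has
only the output stack of `M` filled, so the program must have emptied all its stacks but `out`,
which the transfer empties. -/
theorem decidesWithin_precompose [Fintype K] {p : StackProg K Computability.Γ'} {inp out : K}
    (M : TM2ComputableAux Computability.Γ' Bool) {w w' : List Computability.Γ'} {t : ℕ}
    (hp : p.Exec (Function.update (fun _ => []) inp w)
      (Function.update (fun _ => []) out w'.reverse) t)
    {P : Prop} {s : ℝ} (hM : DecidesWithin M w' P s) :
    DecidesWithin (precompose p inp out M) w P (t + (w'.length + 1) + s) := by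
  obtain ⟨s', hs', ⟨⟨⟨u, hu⟩, hus⟩⟩⟩ := hM
  refine ⟨t + (w'.length + 1) + s', by push_cast; linarith,
    ⟨⟨⟨t + (w'.length + 1) + u, ?_⟩, Nat.add_le_add_left hus _⟩⟩⟩
  obtain ⟨o, h₁⟩ := hp.stepsTo_code (m := precomposeCode p out M) (.inl (.inr ()))
    (fun l => .inl (.inl l)) (fun _ => rfl) none M.tm.initialState (fun _ => [])
  have h₂ := stepsTo_transfer p out M w'.reverse
    (Function.update (fun _ => []) out w'.reverse) [] o (by simp)
  rw [Function.update_idem, Function.update_eq_self_iff.2 rfl] at h₂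
  have h₃ := iterate_embedCfg (L := p.Label ⊕ Unit) none
    (Function.update (fun _ => []) out ([] : List Computability.Γ'))
    (mt := M.tm.m) (m := precomposeCode p out M) (fun _ => rfl) u
    (some (initList M.tm (w'.map M.inputAlphabet.invFun)))
  have hu' : (flip bind (TM2.step M.tm.m))^[u]
    (some (initList M.tm (w'.map M.inputAlphabet.invFun))) = _ := hu
  rw [hu'] at h₃
  have h₄ := (h₁.trans h₂)
  rw [List.reverse_reverse, List.append_nil, List.length_reverse] at h₄
  have h₅ := h₄.trans (show StepsTo _ u _ _ from h₃)
  have e₁ : initList (precompose p inp out M).tm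
      (w.map (precompose p inp out M).inputAlphabet.invFun) =
      ⟨some (.inl (.inl p.start)), (none, M.tm.initialState),
        joinStk (Function.update (fun _ => []) inp w) (fun _ => [])⟩ := by
    rw [initList_eq_update]
    refine congrArg (TM2.Cfg.mk (some (Sum.inl (Sum.inl p.start))) (none, M.tm.initialState)) ?_
    rw [← update_joinStk_inl]
    have h₀ : (joinStk (fun _ => []) (fun _ => []) :
        ∀ k, List (JoinAlphabet K Computability.Γ' M.tm.Γ k)) = fun _ => [] := by
      funext k
      cases k <;> rfl
    rw [h₀]
    refine congrArg (Function.update _ _) (List.map_id w)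
  have e₂ : haltList (precompose p inp out M).tm
      ((Computability.encodeBool (@decide P (Classical.propDecidable P))).map
        (precompose p inp out M).outputAlphabet.invFun) =
      embedCfg (p.Label ⊕ Unit) none (Function.update (fun _ => []) out [])
        (haltList M.tm ((Computability.encodeBool (@decide P (Classical.propDecidable P))).map
          M.outputAlphabet.invFun)) := by
    rw [haltList_eq_update, haltList_eq_update]
    refine congrArg (TM2.Cfg.mk none (none, M.tm.initialState)) ?_
    rw [← update_joinStk_inr]
    have h₀ : (joinStk (Function.update (fun _ => []) out []) (fun _ => []) :
        ∀ k, List (JoinAlphabet K Computability.Γ' M.tm.Γ k)) = fun _ => [] := by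
      rw [Function.update_eq_self_iff.2 rfl]
      funext k
      cases k <;> rfl
    rw [h₀]
    rfl
  rw [e₁]
  refine Eq.trans h₅ ?_
  rw [← e₂]
  rfl

end StackProg

/-! ### Time bounds for loops -/

namespace StackProg

section Generic

variable {K A : Type} [DecidableEq K]

/-- Started on `S`, the program `p` stops with `S'` after at most `t` steps. -/
def RunsIn (p : StackProg K A) (S S' : K → List A) (t : ℕ) : Prop :=
  ∃ t' ≤ t, p.Exec S S' t'

theorem RunsIn.mono {p : StackProg K A} {S S' : K → List A} {t t' : ℕ} (h : p.RunsIn S S' t)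
    (ht : t ≤ t') : p.RunsIn S S' t' :=
  let ⟨u, hu, hp⟩ := h
  ⟨u, hu.trans ht, hp⟩

theorem RunsIn.seq {p q : StackProg K A} {S S' S'' : K → List A} {t t' : ℕ}
    (h : p.RunsIn S S' t) (h' : q.RunsIn S' S'' t') : (p.seq q).RunsIn S S'' (t + t') :=
  let ⟨_, hu, hp⟩ := h
  let ⟨_, hu', hp'⟩ := h'
  ⟨_, Nat.add_le_add hu hu', hp.seq hp'⟩

theorem RunsIn.pop {k : K} {f : Option A → StackProg K A} {S S' : K → List A} {t : ℕ}
    (h : (f (S k).head?).RunsIn (Function.update S k (S k).tail) S' t) :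
    (StackProg.pop k f).RunsIn S S' (t + 1) :=
  let ⟨_, hu, hp⟩ := h
  ⟨_, Nat.add_le_add_right hu 1, hp.pop⟩

theorem RunsIn.loop_exit {k : K} {c : Option A → Bool} {f : Option A → StackProg K A}
    {S : K → List A} (h : c (S k).head? = false) :
    (StackProg.loop k c f).RunsIn S (Function.update S k (S k).tail) 1 :=
  ⟨_, le_rfl, Exec.loop_exit h⟩

theorem RunsIn.loop_step {k : K} {c : Option A → Bool} {f : Option A → StackProg K A}
    {S S' S'' : K → List A} {t t' : ℕ} (h : c (S k).head? = true)
    (hf : (f (S k).head?).RunsIn (Function.update S k (S k).tail) S' t)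
    (hl : (StackProg.loop k c f).RunsIn S' S'' t') :
    (StackProg.loop k c f).RunsIn S S'' (1 + t + t') :=
  let ⟨_, hu, hp⟩ := hf
  let ⟨_, hu', hp'⟩ := hl
  ⟨_, Nat.add_le_add (Nat.add_le_add_left hu 1) hu', hp.loop_step h hp'⟩

/-- A loop through the whole stack `k`. -/
theorem RunsIn.loop_list {k : K} {f : Option A → StackProg K A} {c : ℕ} (l : List A)
    (F : ℕ → K → List A)
    (h : ∀ i (hi : i < l.length), (f (some l[i])).RunsIn
      (Function.update (F i) k (l.drop (i + 1))) (Function.update (F (i + 1)) k (l.drop (i + 1))) c) :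
    (StackProg.loop k Option.isSome f).RunsIn (Function.update (F 0) k l)
      (Function.update (F l.length) k []) (l.length * (c + 1) + 1) := by
  induction l generalizing F with
  | nil =>
    have := RunsIn.loop_exit (k := k) (c := Option.isSome) (f := f)
      (S := Function.update (F 0) k []) (by simp)
    simpa using this
  | cons a l ih =>
    have h₀ := h 0 (by simp)
    have h₁ := ih (fun i => F (i + 1)) fun i hi => by
      have := h (i + 1) (by simpa using hi)
      simpa using this
    simp only [List.getElem_cons_zero, Nat.zero_add, List.drop_succ_cons, List.drop_zero] at h₀
    refine (RunsIn.loop_step (t := c) (by simp) ?_ h₁).mono ?_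
    · simpa using h₀
    · simp only [List.length_cons, Nat.add_mul]
      omega

/-- Move the stack `k` to the stack `k'`, in reverse order. -/
def move (k k' : K) : StackProg K Computability.Γ' :=
  loop k Option.isSome fun o => push k' (o.getD .blank)

theorem runsIn_move {k k' : K} (hk : k ≠ k') (S : K → List Computability.Γ') :
    (move k k').RunsIn S (Function.update (Function.update S k' ((S k).reverse ++ S k')) k [])
      ((S k).length * 2 + 1) := by
  have := RunsIn.loop_list (k := k) (f := fun o => push k' (o.getD .blank)) (c := 1) (S k)
    (fun i => Function.update S k' (((S k).take i).reverse ++ S k')) fun i hi => by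
      refine ⟨1, le_rfl, ?_⟩
      have h := Exec.push k' (S k)[i] (Function.update (Function.update S k'
        (((S k).take i).reverse ++ S k')) k ((S k).drop (i + 1)))
      rw [Function.update_of_ne hk.symm, Function.update_self,
        Function.update_comm hk.symm _ _ S, Function.update_idem, ← Function.update_comm hk.symm _ _ S,
        ← Function.update_comm hk.symm _ _ S] at h
      rw [List.take_succ_eq_append_getElem hi, List.reverse_append, List.append_assoc]
      exact h
  simpa [move] using this

/-- Run `p` once for every mark on the stack `k`, and restore the stack with the help of the stack
`k'`. -/
def forEach (k k' : K) (p : StackProg K Computability.Γ') : StackProg K Computability.Γ' :=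
  seq (loop k Option.isSome fun _ => seq (push k' .blank) p) (move k' k)

/-- A stack with `n` marks. -/
abbrev marks (n : ℕ) : List Computability.Γ' := List.replicate n .blank

/-- `F i` describes the other stacks after `i` rounds; its values at `k` and `k'` are overwritten. A
round costs `c` for the body, two steps to take and store the mark, and two to move it back at the
end. -/
theorem runsIn_forEach {k k' : K} (hk : k ≠ k') {p : StackProg K Computability.Γ'} {c N : ℕ}
    (F : ℕ → K → List Computability.Γ')
    (h : ∀ i < N, p.RunsIn
      (Function.update (Function.update (F i) k' (marks (i + 1))) k (marks (N - (i + 1))))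
      (Function.update (Function.update (F (i + 1)) k' (marks (i + 1))) k (marks (N - (i + 1)))) c) :
    (forEach k k' p).RunsIn (Function.update (Function.update (F 0) k' []) k (marks N))
      (Function.update (Function.update (F N) k' []) k (marks N)) (N * (c + 4) + 2) := by
  have h₁ := RunsIn.loop_list (k := k) (f := fun _ => seq (push k' .blank) p) (c := 1 + c)
    (marks N) (fun i => Function.update (F i) k' (marks i)) fun i hi => by
      simp only [List.length_replicate] at hi
      have h₀ := Exec.push k' .blank (Function.update (Function.update (F i) k' (marks i)) k
        ((marks N).drop (i + 1)))
      rw [Function.update_of_ne hk.symm, Function.update_self,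
        Function.update_comm hk.symm _ _ (F i), Function.update_idem,
        ← Function.update_comm hk.symm _ _ (F i), ← Function.update_comm hk.symm _ _ (F i)] at h₀
      refine RunsIn.seq ⟨1, le_rfl, h₀⟩ ?_
      have := h i hi
      simpa [List.drop_replicate, List.replicate_succ] using this
  simp only [List.length_replicate] at h₁
  have h₂ := RunsIn.seq h₁ (runsIn_move hk.symm _)
  rw [Function.update_of_ne hk.symm, Function.update_self, Function.update_self,
    Function.update_idem, Function.update_comm hk.symm _ _ (F N), Function.update_idem,
    ← Function.update_comm hk.symm _ _ (F N)] at h₂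
  simp only [List.length_replicate, List.reverse_replicate, List.append_nil] at h₂
  refine h₂.mono (le_of_eq ?_)
  ring

end Generic

/-! ### The twelve stacks of the reduction -/

/-- The stacks of the reduction. -/
inductive Stk
  | inp | out | nn | cl | td | dn | mk | u | bin | t | t₁ | t₂
  deriving DecidableEq

instance : Fintype Stk :=
  ⟨{.inp, .out, .nn, .cl, .td, .dn, .mk, .u, .bin, .t, .t₁, .t₂}, by intro k; cases k <;> decide⟩

/-- The contents of the stacks of the reduction. -/
structure St where
  inp : List Computability.Γ'
  out : List Computability.Γ'
  nn : List Computability.Γ'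
  cl : List Computability.Γ'
  td : List Computability.Γ'
  dn : List Computability.Γ'
  mk' : List Computability.Γ'
  u : List Computability.Γ'
  bin : List Computability.Γ'
  t : List Computability.Γ'
  t₁ : List Computability.Γ'
  t₂ : List Computability.Γ'

namespace St

/-- The content of one stack. -/
def get (s : St) : Stk → List Computability.Γ'
  | .inp => s.inp
  | .out => s.out
  | .nn => s.nn
  | .cl => s.cl
  | .td => s.td
  | .dn => s.dn
  | .mk => s.mk'
  | .u => s.u
  | .bin => s.bin
  | .t => s.t
  | .t₁ => s.t₁
  | .t₂ => s.t₂

/-- Change the content of one stack. -/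
def set (s : St) (k : Stk) (l : List Computability.Γ') : St :=
  match k with
  | .inp => { s with inp := l }
  | .out => { s with out := l }
  | .nn => { s with nn := l }
  | .cl => { s with cl := l }
  | .td => { s with td := l }
  | .dn => { s with dn := l }
  | .mk => { s with mk' := l }
  | .u => { s with u := l }
  | .bin => { s with bin := l }
  | .t => { s with t := l }
  | .t₁ => { s with t₁ := l }
  | .t₂ => { s with t₂ := l }

/-- With the stacks as fields of a structure, updates of explicit tuples compute, so that run lemmas
about concrete states compose by definitional unfolding. -/
theorem get_set (s : St) (k : Stk) (l : List Computability.Γ') :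
    (s.set k l).get = Function.update s.get k l := by
  funext j
  cases k <;> cases j <;> rfl

end St

/-- The programs of the reduction. -/
abbrev RProg := StackProg Stk Computability.Γ'

/-- Started on `s`, the program `p` stops with `s'` after at most `t` steps. -/
def Runs (p : RProg) (s s' : St) (t : ℕ) : Prop :=
  p.RunsIn s.get s'.get t

theorem Runs.mono {p : RProg} {s s' : St} {t t' : ℕ} (h : p.Runs s s' t) (ht : t ≤ t') :
    p.Runs s s' t' :=
  RunsIn.mono h ht

theorem Runs.seq {p q : RProg} {s s' s'' : St} {t t' : ℕ} (h : p.Runs s s' t)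
    (h' : q.Runs s' s'' t') : (p.seq q).Runs s s'' (t + t') :=
  RunsIn.seq h h'

theorem runs_skip (s : St) : Runs skip s s 1 :=
  ⟨1, le_rfl, Exec.skip _⟩

theorem runs_push (k : Stk) (a : Computability.Γ') (s : St) :
    Runs (push k a) s (s.set k (a :: s.get k)) 1 :=
  ⟨1, le_rfl, by rw [St.get_set]; exact Exec.push _ _ _⟩

theorem Runs.pop {k : Stk} {f : Option Computability.Γ' → RProg} {s s' : St} {t : ℕ}
    (h : (f (s.get k).head?).Runs (s.set k (s.get k).tail) s' t) :
    Runs (StackProg.pop k f) s s' (t + 1) := by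
  unfold Runs at *
  rw [St.get_set] at h
  exact RunsIn.pop h

theorem Runs.loop_exit {k : Stk} {c : Option Computability.Γ' → Bool}
    {f : Option Computability.Γ' → RProg} {s : St} (h : c (s.get k).head? = false) :
    Runs (StackProg.loop k c f) s (s.set k (s.get k).tail) 1 := by
  unfold Runs
  rw [St.get_set]
  exact RunsIn.loop_exit h

theorem Runs.loop_step {k : Stk} {c : Option Computability.Γ' → Bool}
    {f : Option Computability.Γ' → RProg} {s s' s'' : St} {t t' : ℕ}
    (h : c (s.get k).head? = true)
    (hf : (f (s.get k).head?).Runs (s.set k (s.get k).tail) s' t)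
    (hl : Runs (StackProg.loop k c f) s' s'' t') :
    Runs (StackProg.loop k c f) s s'' (1 + t + t') := by
  unfold Runs at *
  rw [St.get_set] at hf
  exact RunsIn.loop_step h hf hl

theorem Runs.loop_list {k : Stk} {f : Option Computability.Γ' → RProg} {c : ℕ}
    (l : List Computability.Γ') (F : ℕ → St)
    (h : ∀ i (hi : i < l.length), (f (some l[i])).Runs
      ((F i).set k (l.drop (i + 1))) ((F (i + 1)).set k (l.drop (i + 1))) c) :
    Runs (StackProg.loop k Option.isSome f) ((F 0).set k l) ((F l.length).set k [])
      (l.length * (c + 1) + 1) := by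
  unfold Runs at *
  simp only [St.get_set] at h ⊢
  exact RunsIn.loop_list l (fun i => (F i).get) h

theorem runs_move {k k' : Stk} (hk : k ≠ k') (s : St) :
    Runs (move k k') s ((s.set k' ((s.get k).reverse ++ s.get k')).set k [])
      ((s.get k).length * 2 + 1) := by
  unfold Runs
  simp only [St.get_set]
  exact runsIn_move hk _

theorem runs_forEach {k k' : Stk} (hk : k ≠ k') {p : RProg} {c : ℕ} (N : ℕ) (F : ℕ → St)
    (h : ∀ i < N, p.Runs
      (((F i).set k' (marks (i + 1))).set k (marks (N - (i + 1))))
      (((F (i + 1)).set k' (marks (i + 1))).set k (marks (N - (i + 1)))) c) :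
    Runs (forEach k k' p) (((F 0).set k' []).set k (marks N)) (((F N).set k' []).set k (marks N))
      (N * (c + 4) + 2) := by
  unfold Runs at *
  simp only [St.get_set] at h ⊢
  exact runsIn_forEach hk (fun i => (F i).get) h

end StackProg

/-! ### Writing constant words and zeros -/

namespace StackProg

open Computability (Γ')

/-- Write a word to the output stack. -/
def emit (l : List Γ') : RProg := l.foldr (fun a p => seq (push .out a) p) skip

/-- The output stack holds the output in reverse, with the latest symbol on top. -/
theorem runs_emit (l : List Γ') (s : St) :
    Runs (emit l) s (s.set .out (l.reverse ++ s.out)) (l.length + 1) := by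
  induction l generalizing s with
  | nil => exact runs_skip s
  | cons a l ih =>
    have h := ((runs_push .out a s).seq (ih _)).mono (t' := (a :: l).length + 1)
      (by simp only [List.length_cons]; omega)
    simpa [St.set, St.get, emit] using h

/-- The encoding of `2 * d` zeros. -/
abbrev zeros (d : ℕ) : List Γ' := List.replicate (2 * d) Γ'.comma

/-- Write two zeros for every mark on the stack `k`. -/
def emitZeros (k : Stk) : RProg := forEach k .t₁ (emit [.comma, .comma])

theorem runs_emitZeros {k : Stk} (hk : k ≠ .t₁) (hk' : k ≠ .out) {s : St} {d : ℕ}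
    (hd : s.get k = marks d) (ht : s.t₁ = []) :
    Runs (emitZeros k) s (s.set .out (zeros d ++ s.out)) (7 * d + 2) := by
  have := runs_forEach hk (p := emit [.comma, .comma]) (c := 3) d
    (fun i => s.set .out (zeros i ++ s.out)) fun i _ => by
      have h := runs_emit [.comma, .comma] (((s.set .out (zeros i ++ s.out)).set .t₁
        (marks (i + 1))).set k (marks (d - (i + 1))))
      have e : zeros (i + 1) = Γ'.comma :: Γ'.comma :: zeros i := rfl
      obtain ⟨⟩ := s
      cases k <;> first | exact absurd rfl hk | exact absurd rfl hk' | exact h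
  refine Runs.mono (t := d * (3 + 4) + 2) ?_ (by omega)
  obtain ⟨⟩ := s
  subst ht
  cases k <;> first | exact absurd rfl hk | exact absurd rfl hk' | (subst hd; exact this)

/-! ### Reading binary numbers into unary -/

section ReadNumber

/-- Double the number of marks on the stack `u`. -/
def double : RProg :=
  seq (loop .u Option.isSome fun _ => seq (push .t .blank) (push .t .blank)) (move .t .u)

theorem runs_double (inp out nn cl td dn mk bin t₁ t₂ : List Γ') (x : ℕ) :
    Runs double ⟨inp, out, nn, cl, td, dn, mk, marks x, bin, [], t₁, t₂⟩
      ⟨inp, out, nn, cl, td, dn, mk, marks (2 * x), bin, [], t₁, t₂⟩ (7 * x + 2) := by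
  have h₁ := Runs.loop_list (k := .u) (c := 2)
    (f := fun _ => seq (push .t .blank) (push .t .blank)) (marks x)
    (fun i => ⟨inp, out, nn, cl, td, dn, mk, [], bin, marks (2 * i), t₁, t₂⟩)
    fun i _ => (runs_push _ _ _).seq (runs_push _ _ _)
  simp only [List.length_replicate] at h₁
  have h₂ := runs_move (k := .t) (k' := .u) (by decide)
    ⟨inp, out, nn, cl, td, dn, mk, [], bin, marks (2 * x), t₁, t₂⟩
  simp only [St.get, St.set, List.reverse_replicate, List.append_nil, List.length_replicate] at h₂
  exact (Runs.seq h₁ h₂).mono (by omega)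

/-- The number with the given binary digits, least significant digit first. -/
def digitsValue : List Bool → ℕ
  | [] => 0
  | b :: l => b.toNat + 2 * digitsValue l

theorem digitsValue_encodePosNum (p : PosNum) :
    digitsValue (Computability.encodePosNum p) = (p : ℕ) := by
  induction p with
  | one => rfl
  | bit0 p ih => simp [Computability.encodePosNum, digitsValue, ih, PosNum.cast_bit0]; omega
  | bit1 p ih => simp [Computability.encodePosNum, digitsValue, ih, PosNum.cast_bit1]; omega

theorem digitsValue_encodeNat (x : ℕ) : digitsValue (Computability.encodeNat x) = x := by
  have h : ((x : Num) : ℕ) = x := Num.to_of_nat x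
  unfold Computability.encodeNat
  cases hx : (x : Num) with
  | zero => rw [hx] at h; exact h
  | pos p =>
    rw [hx] at h
    rw [← h]
    exact digitsValue_encodePosNum p

theorem length_encodePosNum_le (p : PosNum) :
    (Computability.encodePosNum p).length ≤ (p : ℕ) := by
  induction p with
  | one => simp [Computability.encodePosNum]
  | bit0 p ih =>
    have := PosNum.cast_pos (α := ℕ) p
    simp [Computability.encodePosNum, PosNum.cast_bit0]; omega
  | bit1 p ih =>
    have := PosNum.cast_pos (α := ℕ) p
    simp [Computability.encodePosNum, PosNum.cast_bit1]; omega

/-- A crude bound instead of a logarithmic one suffices: the program keeps its numbers in unary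
anyway. -/
theorem length_encodeNat_le (x : ℕ) : (Computability.encodeNat x).length ≤ x := by
  have h : ((x : Num) : ℕ) = x := Num.to_of_nat x
  unfold Computability.encodeNat
  cases hx : (x : Num) with
  | zero => simp [Computability.encodeNum]
  | pos p =>
    rw [hx] at h
    conv_rhs => rw [← h]
    exact length_encodePosNum_le p

/-- Read a binary number, most significant digit first, from the stack `bin`. -/
def toUnary : RProg :=
  loop .bin Option.isSome fun o =>
    seq double (if o = some (.bit true) then push .u .blank else skip)

theorem le_foldl_digits (l : List Bool) (x : ℕ) :
    x ≤ l.foldl (fun x b => b.toNat + 2 * x) x := by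
  induction l generalizing x with
  | nil => exact le_rfl
  | cons b l ih => exact le_trans (show x ≤ b.toNat + 2 * x by omega) (ih _)

/-- Horner's scheme, most significant digit first. A round costs `7 * x + 4` steps at the current
value `x`, and `le_foldl_digits` bounds the intermediate values by the final one. -/
theorem runs_toUnary_foldl (inp out nn cl td dn mk t₁ t₂ : List Γ') (l : List Bool) (x : ℕ) :
    Runs toUnary
      ⟨inp, out, nn, cl, td, dn, mk, marks x, l.map Γ'.bit, [], t₁, t₂⟩
      ⟨inp, out, nn, cl, td, dn, mk, marks (l.foldl (fun x b => b.toNat + 2 * x) x), [], [], t₁, t₂⟩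
      (l.length * (7 * l.foldl (fun x b => b.toNat + 2 * x) x + 4) + 1) := by
  induction l generalizing x with
  | nil => exact (Runs.loop_exit rfl).mono (by omega)
  | cons b l ih =>
    have h₁ : Runs (if some (Γ'.bit b) = some (Γ'.bit true) then push .u .blank else skip)
        ⟨inp, out, nn, cl, td, dn, mk, marks (2 * x), l.map Γ'.bit, [], t₁, t₂⟩
        ⟨inp, out, nn, cl, td, dn, mk, marks (b.toNat + 2 * x), l.map Γ'.bit, [], t₁, t₂⟩ 1 := by
      cases b
      · rw [if_neg (by simp), Bool.toNat_false, Nat.zero_add]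
        exact runs_skip _
      · rw [if_pos rfl, Bool.toNat_true, Nat.add_comm]
        exact runs_push _ _ _
    have h₂ := Runs.loop_step (k := .bin) (c := Option.isSome)
      (s := ⟨inp, out, nn, cl, td, dn, mk, marks x, (b :: l).map Γ'.bit, [], t₁, t₂⟩) rfl
      ((runs_double inp out nn cl td dn mk (l.map Γ'.bit) t₁ t₂ x).seq h₁)
      (ih (b.toNat + 2 * x))
    refine Runs.mono h₂ ?_
    have := le_foldl_digits l (b.toNat + 2 * x)
    simp only [List.length_cons, List.foldl_cons, Nat.add_mul]
    omega

theorem foldl_reverse_digits (l : List Bool) :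
    l.reverse.foldl (fun x b => b.toNat + 2 * x) 0 = digitsValue l := by
  rw [List.foldl_reverse]
  induction l with
  | nil => rfl
  | cons b l ih => simp only [List.foldr_cons, ih, digitsValue]

/-- Read a number from the input, and write it to the stack `u` in unary. -/
def readNumber : RProg :=
  seq (loop .inp (fun o => decide (o ≠ some .comma)) fun o => push .bin (o.getD .blank)) toUnary

/-- The digits arrive least significant first, so stacking them puts the most significant one on
top. The comma is consumed as the symbol on which the loop test fails. -/
theorem runs_readDigits (out nn cl td dn mk u t t₁ t₂ rest : List Γ') (l : List Bool)
    (bin : List Γ') :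
    Runs (loop .inp (fun o => decide (o ≠ some .comma)) fun o => push .bin (o.getD .blank))
      ⟨l.map Γ'.bit ++ Γ'.comma :: rest, out, nn, cl, td, dn, mk, u, bin, t, t₁, t₂⟩
      ⟨rest, out, nn, cl, td, dn, mk, u, (l.map Γ'.bit).reverse ++ bin, t, t₁, t₂⟩
      (2 * l.length + 1) := by
  induction l generalizing bin with
  | nil => exact Runs.loop_exit (by simp [St.get])
  | cons b l ih =>
    refine Runs.mono (Runs.loop_step (t := 1) (by simp [St.get]) (runs_push _ _ _)
      (s'' := ⟨rest, out, nn, cl, td, dn, mk, u, ((b :: l).map Γ'.bit).reverse ++ bin, t, t₁, t₂⟩)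
      (t' := 2 * l.length + 1) ?_) (by simp only [List.length_cons]; omega)
    have := ih (Γ'.bit b :: bin)
    simpa [St.get, St.set] using this

theorem runs_readNumber (out nn cl td dn mk t₁ t₂ rest : List Γ') (x : ℕ) :
    Runs readNumber ⟨encodeNumber x ++ rest, out, nn, cl, td, dn, mk, [], [], [], t₁, t₂⟩
      ⟨rest, out, nn, cl, td, dn, mk, marks x, [], [], t₁, t₂⟩ (7 * (x + 1) ^ 2) := by
  have h₁ := runs_readDigits out nn cl td dn mk [] [] t₁ t₂ rest (Computability.encodeNat x) []
  have h₂ := runs_toUnary_foldl rest out nn cl td dn mk t₁ t₂ (Computability.encodeNat x).reverse 0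
  rw [foldl_reverse_digits, digitsValue_encodeNat, List.length_reverse, List.map_reverse] at h₂
  rw [List.append_nil] at h₁
  have h₃ := h₁.seq h₂
  have e : encodeNumber x ++ rest =
      (Computability.encodeNat x).map Γ'.bit ++ Γ'.comma :: rest := by simp [encodeNumber]
  rw [e]
  refine Runs.mono h₃ ?_
  have := length_encodeNat_le x
  nlinarith

end ReadNumber

/-! ### A binary counter -/

section Counter

/-- Increment the binary counter on the stack `bin`. -/
def increment : RProg :=
  seq (loop .bin (fun o => decide (o = some (.bit true))) fun _ => push .t₂ (.bit false))
    (seq (push .bin (.bit true)) (move .t₂ .bin))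

/-- The binary digits of the successor. -/
def succDigits : List Bool → List Bool
  | true :: l => false :: succDigits l
  | _ :: l => true :: l
  | [] => [true]

theorem encodePosNum_succ (p : PosNum) :
    Computability.encodePosNum p.succ = succDigits (Computability.encodePosNum p) := by
  induction p with
  | one => rfl
  | bit0 p ih => rfl
  | bit1 p ih => simp [PosNum.succ, Computability.encodePosNum, succDigits, ih]

theorem encodeNat_succ (x : ℕ) :
    Computability.encodeNat (x + 1) = succDigits (Computability.encodeNat x) := by
  unfold Computability.encodeNat
  rw [Nat.cast_succ, Num.add_one]
  cases (x : Num) with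
  | zero => rfl
  | pos p => exact encodePosNum_succ p

/-- The loop turns the low-order ones into zeros on `t₂`. Its exit swallows the first zero or finds
the counter exhausted, and in both cases a one is pushed in that place. An arbitrary `t₂` is needed
for the induction. -/
theorem runs_increment_digits (inp out nn cl td dn mk u t t₁ t₂ : List Γ') (l : List Bool) :
    Runs increment ⟨inp, out, nn, cl, td, dn, mk, u, l.map Γ'.bit, t, t₁, t₂⟩
      ⟨inp, out, nn, cl, td, dn, mk, u, t₂.reverse ++ (succDigits l).map Γ'.bit, t, t₁, []⟩
      (4 * l.length + 2 * t₂.length + 3) := by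
  have last : ∀ (s s' : List Γ') (t₂ : List Γ'),
      Runs (seq (push .bin (.bit true)) (move .t₂ .bin))
        ⟨inp, out, nn, cl, td, dn, mk, u, s, t, t₁, t₂⟩
        ⟨inp, out, nn, cl, td, dn, mk, u, t₂.reverse ++ Γ'.bit true :: s, t, t₁, []⟩
        (2 * t₂.length + 2) := fun s s' t₂ =>
    ((runs_push _ _ _).seq (runs_move (by decide) _)).mono (by simp only [St.set, St.get]; omega)
  induction l generalizing t₂ with
  | nil =>
    exact Runs.mono (Runs.seq (Runs.loop_exit rfl) (last [] [] t₂)) (by simp; omega)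
  | cons b l ih =>
    cases b with
    | false =>
      exact Runs.mono (Runs.seq (Runs.loop_exit rfl) (last (l.map Γ'.bit) [] t₂)) (by simp; omega)
    | true =>
      -- The induction hypothesis concerns the whole program. Its run is split into the loop and the
      -- rest, so that one more round can be put in front of the loop.
      obtain ⟨v, hv, h⟩ := ih (Γ'.bit false :: t₂)
      cases h with
      | @seq _ _ _ S _ a b ha hb =>
        have h₀ := (runs_push .t₂ (.bit false)
          ⟨inp, out, nn, cl, td, dn, mk, u, l.map Γ'.bit, t, t₁, t₂⟩)
        have h₁ := RunsIn.loop_step (k := .bin) (c := fun o => decide (o = some (.bit true)))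
          (f := fun _ => push .t₂ (.bit false))
          (S := St.get ⟨inp, out, nn, cl, td, dn, mk, u, Γ'.bit true :: l.map Γ'.bit, t, t₁, t₂⟩)
          rfl (by rw [← St.get_set]; exact h₀) ⟨a, le_rfl, ha⟩
        have h₂ := RunsIn.seq h₁ ⟨b, le_rfl, hb⟩
        have e : t₂.reverse ++ (succDigits (true :: l)).map Γ'.bit =
          (Γ'.bit false :: t₂).reverse ++ (succDigits l).map Γ'.bit := by simp [succDigits]
        rw [e]
        refine RunsIn.mono h₂ ?_
        simp only [List.length_cons] at hv ⊢
        omega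

theorem runs_increment (inp out nn cl td dn mk u t t₁ : List Γ') (x : ℕ) :
    Runs increment
      ⟨inp, out, nn, cl, td, dn, mk, u, (Computability.encodeNat x).map Γ'.bit, t, t₁, []⟩
      ⟨inp, out, nn, cl, td, dn, mk, u, (Computability.encodeNat (x + 1)).map Γ'.bit, t, t₁, []⟩
      (4 * x + 3) := by
  rw [encodeNat_succ]
  refine (runs_increment_digits inp out nn cl td dn mk u t t₁ [] _).mono ?_
  have := length_encodeNat_le x
  simp only [List.length_nil]
  omega

end Counter

end StackProg

namespace StackProg

open Computability (Γ')

/-! ### Counting clauses and writing the dimensions -/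

section Counting

/-- Move the input to the stack `t` and back, and mark every closing bracket on the stack `cl`. -/
def countClauses : RProg :=
  seq (loop .inp Option.isSome fun o =>
    seq (push .t (o.getD .blank)) (if o = some .ket then push .cl .blank else skip)) (move .t .inp)

theorem runs_countClauses_loop (out nn td dn mk u bin t₁ t₂ : List Γ') (l t : List Γ') (c : ℕ) :
    Runs (loop .inp Option.isSome fun o =>
        seq (push .t (o.getD .blank)) (if o = some .ket then push .cl .blank else skip))
      ⟨l, out, nn, marks c, td, dn, mk, u, bin, t, t₁, t₂⟩
      ⟨[], out, nn, marks (c + l.count .ket), td, dn, mk, u, bin, l.reverse ++ t, t₁, t₂⟩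
      (3 * l.length + 1) := by
  induction l generalizing t c with
  | nil => exact Runs.loop_exit rfl
  | cons a l ih =>
    have h₁ : Runs (if some a = some Γ'.ket then push .cl .blank else skip)
        ⟨l, out, nn, marks c, td, dn, mk, u, bin, a :: t, t₁, t₂⟩
        ⟨l, out, nn, marks (c + if a = Γ'.ket then 1 else 0), td, dn, mk, u, bin, a :: t, t₁, t₂⟩
        1 := by
      by_cases ha : a = Γ'.ket
      · rw [if_pos (by rw [ha]), if_pos ha]
        exact runs_push _ _ _
      · rw [if_neg (by simpa using ha), if_neg ha]
        exact runs_skip _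
    have h₂ := Runs.loop_step (k := .inp) (c := Option.isSome)
      (f := fun o =>
        seq (push .t (o.getD .blank)) (if o = some .ket then push .cl .blank else skip))
      (s := ⟨a :: l, out, nn, marks c, td, dn, mk, u, bin, t, t₁, t₂⟩) rfl
      ((runs_push _ _ _).seq h₁) (ih (a :: t) _)
    have e : c + (a :: l).count .ket = (c + if a = Γ'.ket then 1 else 0) + l.count .ket := by
      rw [List.count_cons]
      simp only [beq_iff_eq]
      omega
    rw [e, List.reverse_cons, List.append_assoc]
    exact h₂.mono (by simp only [List.length_cons]; omega)

theorem runs_countClauses (out nn td dn mk u bin t₁ t₂ : List Γ') (l : List Γ') :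
    Runs countClauses
      ⟨l, out, nn, [], td, dn, mk, u, bin, [], t₁, t₂⟩
      ⟨l, out, nn, marks (l.count .ket), td, dn, mk, u, bin, [], t₁, t₂⟩
      (5 * l.length + 2) := by
  have h₁ := runs_countClauses_loop out nn td dn mk u bin t₁ t₂ l [] 0
  rw [Nat.zero_add, List.append_nil] at h₁
  have h₂ := h₁.seq (runs_move (k := .t) (k' := .inp) (by decide) _)
  simp only [St.get, St.set, List.reverse_reverse, List.append_nil, List.length_reverse] at h₂
  exact h₂.mono (by omega)

/-- Write two marks on the stack `td` for every pair of marks on `cl` and `nn`. -/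
def markPositions : RProg :=
  forEach .cl .t₁ (forEach .nn .t₂ (seq (push .td .blank) (push .td .blank)))

theorem runs_markPositions (inp out dn mk u bin t : List Γ') (n m : ℕ) :
    Runs markPositions
      ⟨inp, out, marks n, marks m, [], dn, mk, u, bin, t, [], []⟩
      ⟨inp, out, marks n, marks m, marks (m * (2 * n)), dn, mk, u, bin, t, [], []⟩
      (m * (n * 6 + 2 + 4) + 2) := by
  have h := runs_forEach (k := .cl) (k' := .t₁) (by decide)
    (p := forEach .nn .t₂ (seq (push .td .blank) (push .td .blank))) (c := n * 6 + 2) m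
    (fun i => ⟨inp, out, marks n, [], marks (i * (2 * n)), dn, mk, u, bin, t, [], []⟩)
    fun i _ => by
      have := runs_forEach (k := .nn) (k' := .t₂) (by decide)
        (p := seq (push .td .blank) (push .td .blank)) (c := 2) n
        (fun j => ⟨inp, out, [], marks (m - (i + 1)), marks (i * (2 * n) + 2 * j), dn, mk, u, bin,
          t, marks (i + 1), []⟩)
        fun j _ => (runs_push _ _ _).seq (runs_push _ _ _)
      have e : (i + 1) * (2 * n) = i * (2 * n) + 2 * n := Nat.succ_mul _ _
      simp only [e]
      exact this
  rw [Nat.zero_mul] at h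
  exact h

/-- Converts unary counts back to binary: sums are formed by counting through several stacks in
turn. -/
theorem runs_forEach_increment {k : Stk} (hk : k = .nn ∨ k = .cl ∨ k = .td) {s : St} {N x : ℕ}
    (hN : s.get k = marks N) (ht₁ : s.t₁ = []) (ht₂ : s.t₂ = [])
    (hx : s.bin = (Computability.encodeNat x).map Γ'.bit) :
    Runs (forEach k .t₁ increment) s
      (s.set .bin ((Computability.encodeNat (x + N)).map Γ'.bit)) (N * (4 * (x + N) + 7) + 2) := by
  have hk' : k ≠ .t₁ := by rintro rfl; simp at hk
  have h := runs_forEach hk' (p := increment) (c := 4 * (x + N) + 3) N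
    (fun i => s.set .bin ((Computability.encodeNat (x + i)).map Γ'.bit)) fun i hi => by
      obtain ⟨⟩ := s
      subst ht₂
      rcases hk with rfl | rfl | rfl <;>
        exact (runs_increment _ _ _ _ _ _ _ _ _ _ _).mono (by omega)
  obtain ⟨⟩ := s
  subst ht₁ hx
  rcases hk with rfl | rfl | rfl <;> (subst hN; exact h)

/-- Write the number on the binary counter to the output. -/
def emitCounter : RProg := seq (move .bin .out) (push .out .comma)

theorem runs_emitCounter (inp out nn cl td dn mk u t t₁ t₂ : List Γ') (x : ℕ) :
    Runs emitCounter
      ⟨inp, out, nn, cl, td, dn, mk, u, (Computability.encodeNat x).map Γ'.bit, t, t₁, t₂⟩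
      ⟨inp, (encodeNumber x).reverse ++ out, nn, cl, td, dn, mk, u, [], t, t₁, t₂⟩
      (2 * x + 2) := by
  have h := (runs_move (k := .bin) (k' := .out) (by decide) ⟨inp, out, nn, cl, td, dn, mk, u,
    (Computability.encodeNat x).map Γ'.bit, t, t₁, t₂⟩).seq (runs_push .out .comma _)
  have e : (encodeNumber x).reverse ++ out =
    Γ'.comma :: (((Computability.encodeNat x).map Γ'.bit).reverse ++ out) := by
    simp [encodeNumber]
  rw [e]
  refine Runs.mono h ?_
  have := length_encodeNat_le x
  simp only [St.get, List.length_map]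
  omega

/-- Write the numbers of rows and columns to the output. -/
def emitHeader : RProg :=
  seq (seq (forEach .td .t₁ increment) (seq (forEach .cl .t₁ increment) emitCounter))
    (seq (forEach .td .t₁ increment) (seq (forEach .td .t₁ increment)
      (seq (forEach .nn .t₁ increment) (seq (forEach .nn .t₁ increment) emitCounter))))

theorem runs_emitHeader (inp out dn mk u t : List Γ') (n m d : ℕ) :
    Runs emitHeader
      ⟨inp, out, marks n, marks m, marks d, dn, mk, u, [], t, [], []⟩
      ⟨inp, (encodeNumber (d + m) ++ encodeNumber (2 * (d + n))).reverse ++ out, marks n, marks m,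
        marks d, dn, mk, u, [], t, [], []⟩
      (80 * (d + n + m + 1) ^ 2) := by
  have a₁ := runs_forEach_increment (k := .td) (N := d) (x := 0) (by simp)
    (s := ⟨inp, out, marks n, marks m, marks d, dn, mk, u, [], t, [], []⟩) rfl rfl rfl rfl
  have a₂ := runs_forEach_increment (k := .cl) (by simp) (N := m) (x := 0 + d)
    (s := ⟨inp, out, marks n, marks m, marks d, dn, mk, u,
      (Computability.encodeNat (0 + d)).map Γ'.bit, t, [], []⟩) rfl rfl rfl rfl
  have a₃ := runs_emitCounter inp out (marks n) (marks m) (marks d) dn mk u t [] [] (0 + d + m)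
  have b₁ := runs_forEach_increment (k := .td) (N := d) (x := 0) (by simp)
    (s := ⟨inp, (encodeNumber (0 + d + m)).reverse ++ out, marks n, marks m, marks d, dn, mk, u, [],
      t, [], []⟩) rfl rfl rfl rfl
  have b₂ := runs_forEach_increment (k := .td) (N := d) (x := 0 + d) (by simp)
    (s := ⟨inp, (encodeNumber (0 + d + m)).reverse ++ out, marks n, marks m, marks d, dn, mk, u,
      (Computability.encodeNat (0 + d)).map Γ'.bit, t, [], []⟩) rfl rfl rfl rfl
  have b₃ := runs_forEach_increment (k := .nn) (N := n) (x := 0 + d + d) (by simp)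
    (s := ⟨inp, (encodeNumber (0 + d + m)).reverse ++ out, marks n, marks m, marks d, dn, mk, u,
      (Computability.encodeNat (0 + d + d)).map Γ'.bit, t, [], []⟩) rfl rfl rfl rfl
  have b₄ := runs_forEach_increment (k := .nn) (N := n) (x := 0 + d + d + n) (by simp)
    (s := ⟨inp, (encodeNumber (0 + d + m)).reverse ++ out, marks n, marks m, marks d, dn, mk, u,
      (Computability.encodeNat (0 + d + d + n)).map Γ'.bit, t, [], []⟩) rfl rfl rfl rfl
  have b₅ := runs_emitCounter inp ((encodeNumber (0 + d + m)).reverse ++ out) (marks n) (marks m)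
    (marks d) dn mk u t [] [] (0 + d + d + n + n)
  have h := (a₁.seq (a₂.seq a₃)).seq (b₁.seq (b₂.seq (b₃.seq (b₄.seq b₅))))
  rw [show 0 + d + d + n + n = 2 * (d + n) by ring, Nat.zero_add] at h
  rw [List.reverse_append, List.append_assoc]
  refine Runs.mono h ?_
  nlinarith [Nat.zero_le (d * n), Nat.zero_le (d * m), Nat.zero_le (n * m), sq_nonneg d,
    sq_nonneg n, sq_nonneg m]

end Counting

/-! ### Writing the chain rows -/

section ChainRows

/-- The encoding of two ones. -/
abbrev ones : List Γ' := [.bit true, .comma, .bit true, .comma]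

/-- The encoding of a row with ones in two groups at distance `n + 1`, after `g` groups and
before `r` groups. -/
def chainRowCode (n g r : ℕ) : List Γ' :=
  [.bra] ++ zeros g ++ ones ++ zeros n ++ ones ++ zeros r ++ [.ket]

/-- Write a chain row. -/
def emitChainRow : RProg :=
  seq (emit [.bra]) (seq (emitZeros .dn) (seq (emit ones) (seq (emitZeros .nn) (seq (emit ones)
    (seq (emitZeros .td) (emit [.ket]))))))

theorem reverse_zeros (d : ℕ) : (zeros d).reverse = zeros d := List.reverse_replicate

theorem runs_emitChainRow (inp out cl mk u bin t t₂ : List Γ') (n g r : ℕ) :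
    Runs emitChainRow
      ⟨inp, out, marks n, cl, marks r, marks g, mk, u, bin, t, [], t₂⟩
      ⟨inp, (chainRowCode n g r).reverse ++ out, marks n, cl, marks r, marks g, mk, u, bin, t, [],
        t₂⟩
      (7 * (n + g + r) + 20) := by
  have h := (runs_emit [.bra]
    ⟨inp, out, marks n, cl, marks r, marks g, mk, u, bin, t, [], t₂⟩).seq
    ((runs_emitZeros (k := .dn) (d := g) (by decide) (by decide) rfl rfl).seq ((runs_emit ones _).seq
    ((runs_emitZeros (k := .nn) (d := n) (by decide) (by decide) rfl rfl).seq ((runs_emit ones _).seq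
    ((runs_emitZeros (k := .td) (d := r) (by decide) (by decide) rfl rfl).seq
    (runs_emit [.ket] _))))))
  have e : (chainRowCode n g r).reverse ++ out =
    [Γ'.ket].reverse ++ (zeros r ++ (ones.reverse ++ (zeros n ++ (ones.reverse ++ (zeros g ++
      ([Γ'.bra].reverse ++ out)))))) := by
    simp only [chainRowCode, List.reverse_append, reverse_zeros, List.append_assoc]
  rw [e]
  refine Runs.mono h ?_
  simp only [List.length_cons, List.length_nil]
  omega

/-- Write the chain rows for all marks on the stack `td`, which are moved to `dn`. -/
def emitChainRows : RProg :=
  loop .td Option.isSome fun _ => seq emitChainRow (push .dn .blank)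

/-- During round `g` the marks on `dn` count the groups before the first pair of ones, and those on
`td` the groups after the second pair. The mark just popped accounts for the `1` in `d - (g + 1)`.
-/
theorem runs_emitChainRows (inp out cl mk u bin t t₂ : List Γ') (n d : ℕ) :
    Runs emitChainRows
      ⟨inp, out, marks n, cl, marks d, [], mk, u, bin, t, [], t₂⟩
      ⟨inp, ((List.range d).flatMap fun g => chainRowCode n g (d - (g + 1))).reverse ++ out,
        marks n, cl, [], marks d, mk, u, bin, t, [], t₂⟩
      (d * (7 * (n + d) + 22) + 1) := by
  have h := Runs.loop_list (k := .td) (f := fun _ => seq emitChainRow (push .dn .blank))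
    (c := 7 * (n + d) + 21) (marks d)
    (fun i => ⟨inp, ((List.range i).flatMap fun g => chainRowCode n g (d - (g + 1))).reverse ++ out,
        marks n, cl, [], marks i, mk, u, bin, t, [], t₂⟩) fun i hi => by
      simp only [List.length_replicate] at hi
      have h₁ := (runs_emitChainRow inp
        (((List.range i).flatMap fun g => chainRowCode n g (d - (g + 1))).reverse ++ out) cl mk u
        bin t t₂ n i (d - (i + 1))).seq (runs_push .dn .blank _)
      rw [List.range_succ, List.flatMap_append, List.reverse_append, List.append_assoc,
        List.flatMap_singleton, List.drop_replicate]
      exact h₁.mono (by omega)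
  simp only [List.length_replicate] at h
  exact h

/-- Write all chain rows. The distance of the two groups of a row is the number of marks on `nn`,
and there are no rows if it vanishes. -/
def emitChainBlock : RProg :=
  pop .nn fun o =>
    if o.isSome then seq (seq emitChainRows (move .dn .td)) (push .nn .blank) else skip

/-- Between the groups `g` and `g + n` lie `n - 1` groups, so one mark is taken off `nn` for the
duration of the loop. For `n = 0` there is none to take, and `hd` says that no rows are due. -/
theorem runs_emitChainBlock (inp out cl mk u bin t t₂ : List Γ') (n d : ℕ) (hd : n = 0 → d = 0) :
    Runs emitChainBlock
      ⟨inp, out, marks n, cl, marks d, [], mk, u, bin, t, [], t₂⟩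
      ⟨inp, ((List.range d).flatMap fun g => chainRowCode (n - 1) g (d - (g + 1))).reverse ++ out,
        marks n, cl, marks d, [], mk, u, bin, t, [], t₂⟩
      (d * (7 * (n + d) + 24) + 4) := by
  cases n with
  | zero =>
    rw [hd rfl]
    exact (Runs.pop (runs_skip _)).mono (by omega)
  | succ n =>
    have h := ((runs_emitChainRows inp out cl mk u bin t t₂ n d).seq
      (runs_move (k := .dn) (k' := .td) (by decide) _)).seq (runs_push .nn .blank _)
    simp only [St.get, St.set, List.reverse_replicate, List.append_nil, List.length_replicate] at h
    have h' : Runs emitChainBlock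
      ⟨inp, out, marks (n + 1), cl, marks d, [], mk, u, bin, t, [], t₂⟩ _ _ := Runs.pop h
    refine Runs.mono h' ?_
    nlinarith

end ChainRows

end StackProg

namespace StackProg

open Computability (Γ')

/-! ### Reading clauses and writing their rows -/

section ClauseRows

/-- The position of a literal among the `2 * n` literals: first all negative and then all positive
ones. -/
def litPos {n : ℕ} (l : Fin n × Bool) : ℕ := if l.2 then l.1 + n else l.1

theorem litPos_lt {n : ℕ} (l : Fin n × Bool) : litPos l < 2 * n := by
  unfold litPos
  split_ifs <;> omega

/-- Mark the positions of the given literals. -/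
def addMask {n : ℕ} (C : List (Fin n × Bool)) (mask : List Bool) : List Bool :=
  C.foldl (fun mask l => mask.set (litPos l) true) mask

/-- The literals of a clause, as a list of `2 * n` truth values. -/
def clauseMask {n : ℕ} (C : List (Fin n × Bool)) : List Bool :=
  addMask C (List.replicate (2 * n) false)

theorem length_addMask {n : ℕ} (C : List (Fin n × Bool)) (mask : List Bool) :
    (addMask C mask).length = mask.length := by
  induction C generalizing mask with
  | nil => rfl
  | cons l C ih => exact (ih _).trans (List.length_set)

/-- The symbol for an entry of a mask. -/
def maskSymbol (b : Bool) : Γ' := if b then .bit true else .blank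

/-- Set the entry of the mask on the stack `mk` at the position given by the marks on `u`. -/
def setBit : RProg :=
  seq (loop .u Option.isSome fun _ => pop .mk fun o => push .t (o.getD .blank))
    (seq (pop .mk fun _ => push .mk (.bit true)) (move .t .mk))

theorem runs_setBit (inp out nn cl td dn bin t₁ t₂ : List Γ') (mask : List Bool) (p : ℕ)
    (hp : p < mask.length) :
    Runs setBit
      ⟨inp, out, nn, cl, td, dn, mask.map maskSymbol, marks p, bin, [], t₁, t₂⟩
      ⟨inp, out, nn, cl, td, dn, (mask.set p true).map maskSymbol, [], bin, [], t₁, t₂⟩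
      (5 * p + 4) := by
  set L := mask.map maskSymbol with hL
  have hpL : p < L.length := by simpa [hL] using hp
  have h₁ := Runs.loop_list (k := .u) (f := fun _ => pop .mk fun o => push .t (o.getD .blank))
    (c := 2) (marks p)
    (fun i => ⟨inp, out, nn, cl, td, dn, L.drop i, [], bin, (L.take i).reverse, t₁, t₂⟩)
    fun i hi => by
      simp only [List.length_replicate] at hi
      have hi' : i < L.length := hi.trans hpL
      refine Runs.pop ?_
      have h := runs_push .t L[i] ⟨inp, out, nn, cl, td, dn, L.drop (i + 1),
        (marks p).drop (i + 1), bin, (L.take i).reverse, t₁, t₂⟩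
      simp only [St.get, St.set, List.drop_eq_getElem_cons hi', List.head?_cons, List.tail_cons,
        Option.getD_some] at h ⊢
      rw [List.take_succ_eq_append_getElem hi', List.reverse_append]
      exact h
  simp only [List.length_replicate, List.drop_zero, List.take_zero] at h₁
  have h₂ : Runs (pop .mk fun _ => push .mk (.bit true))
      ⟨inp, out, nn, cl, td, dn, L.drop p, [], bin, (L.take p).reverse, t₁, t₂⟩
      ⟨inp, out, nn, cl, td, dn, .bit true :: L.drop (p + 1), [], bin, (L.take p).reverse, t₁, t₂⟩
      2 := by
    refine Runs.pop ?_
    have h := runs_push .mk (.bit true)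
      ⟨inp, out, nn, cl, td, dn, L.drop (p + 1), [], bin, (L.take p).reverse, t₁, t₂⟩
    simp only [St.get, St.set, List.drop_eq_getElem_cons hpL, List.tail_cons] at h ⊢
    exact h
  have h₃ := runs_move (k := .t) (k' := .mk) (by decide)
    ⟨inp, out, nn, cl, td, dn, .bit true :: L.drop (p + 1), [], bin, (L.take p).reverse, t₁, t₂⟩
  have e : (mask.set p true).map maskSymbol = L.take p ++ Γ'.bit true :: L.drop (p + 1) := by
    rw [List.map_set, List.set_eq_take_append_cons_drop, if_pos (by simpa using hp)]
    rfl
  have h := Runs.seq h₁ (h₂.seq h₃)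
  simp only [St.get, St.set, List.reverse_reverse, List.length_reverse, List.length_take] at h
  rw [e]
  refine Runs.mono h ?_
  have : min p L.length = p := min_eq_left hpL.le
  omega

/-- Read the literals of a clause from the input, and mark them in the mask. -/
def readLiterals : RProg :=
  loop .inp (fun o => decide (o ≠ some .ket)) fun o =>
    seq readNumber (seq (if o = some (.bit true) then forEach .nn .t₁ (push .u .blank) else skip)
      setBit)

/-- The code of a list of literals. -/
def literalsCode {n : ℕ} (C : List (Fin n × Bool)) : List Γ' :=
  C.flatMap fun l => Γ'.bit l.2 :: encodeNumber (l.1 : ℕ)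

/-- The loop itself pops the sign bit of a literal, which tells the body whether to shift the
position by `n`; the closing bracket fails the test and is consumed. The cost per literal combines
reading an index below `n`, the shift, and `setBit` at a position below `2 * n`. -/
theorem runs_readLiterals {n : ℕ} (out cl td dn t₂ rest : List Γ') (C : List (Fin n × Bool))
    (mask : List Bool) (hmask : mask.length = 2 * n) :
    Runs readLiterals
      ⟨literalsCode C ++ Γ'.ket :: rest, out, marks n, cl, td, dn, mask.map maskSymbol, [], [], [],
        [], t₂⟩
      ⟨rest, out, marks n, cl, td, dn, (addMask C mask).map maskSymbol, [], [], [], [], t₂⟩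
      (C.length * (7 * n ^ 2 + 15 * n + 7) + 1) := by
  induction C generalizing mask with
  | nil => exact (Runs.loop_exit (by simp [St.get, literalsCode])).mono (by omega)
  | cons l C ih =>
    obtain ⟨v, b⟩ := l
    have h₁ := runs_readNumber out (marks n) cl td dn (mask.map maskSymbol) [] t₂
      (literalsCode C ++ Γ'.ket :: rest) v
    have h₂ : Runs (if some (Γ'.bit b) = some (Γ'.bit true) then forEach .nn .t₁ (push .u .blank)
          else skip)
        ⟨literalsCode C ++ Γ'.ket :: rest, out, marks n, cl, td, dn, mask.map maskSymbol, marks v,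
          [], [], [], t₂⟩
        ⟨literalsCode C ++ Γ'.ket :: rest, out, marks n, cl, td, dn, mask.map maskSymbol,
          marks (litPos (v, b)), [], [], [], t₂⟩ (5 * n + 2) := by
      cases b
      · rw [if_neg (by simp)]
        exact (runs_skip _).mono (by omega)
      · rw [if_pos rfl]
        have := runs_forEach (k := .nn) (k' := .t₁) (by decide) (p := push .u .blank) (c := 1) n
          (fun i => ⟨literalsCode C ++ Γ'.ket :: rest, out, [], cl, td, dn, mask.map maskSymbol,
            marks (v + i), [], [], [], t₂⟩) fun i _ => runs_push _ _ _
        refine Runs.mono this (by omega)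
    have hp := litPos_lt (v, b)
    have h₃ := runs_setBit (literalsCode C ++ Γ'.ket :: rest) out (marks n) cl td dn [] [] t₂ mask
      (litPos (v, b)) (by omega)
    have h₄ := ih (mask.set (litPos (v, b)) true) (by simpa using hmask)
    have e : literalsCode ((v, b) :: C) ++ Γ'.ket :: rest =
        Γ'.bit b :: (encodeNumber v ++ (literalsCode C ++ Γ'.ket :: rest)) := by
      simp [literalsCode]
    rw [e]
    have h := Runs.loop_step (k := .inp) (c := fun o => decide (o ≠ some .ket))
      (f := fun o => seq readNumber
        (seq (if o = some (.bit true) then forEach .nn .t₁ (push .u .blank) else skip) setBit))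
      (s := ⟨Γ'.bit b :: (encodeNumber v ++ (literalsCode C ++ Γ'.ket :: rest)), out, marks n, cl,
        td, dn, mask.map maskSymbol, [], [], [], [], t₂⟩) (by simp [St.get])
      (h₁.seq (h₂.seq h₃)) h₄
    refine Runs.mono h ?_
    have hv : (v : ℕ) + 1 ≤ n := v.2
    have := Nat.pow_le_pow_left hv 2
    simp only [List.length_cons, Nat.add_mul]
    omega

/-- The entries of a clause row that belong to the given mask. -/
def maskCode (mask : List Bool) : List Γ' :=
  mask.flatMap fun b => if b then [.comma, .bit true, .comma] else [.comma, .comma]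

/-- Write the entries for the mask on the stack `mk`. -/
def emitMask : RProg :=
  loop .mk Option.isSome fun o =>
    if o = some (.bit true) then emit [.comma, .bit true, .comma] else emit [.comma, .comma]

theorem runs_emitMask (inp out nn cl td dn u bin t t₁ t₂ : List Γ') (mask : List Bool) :
    Runs emitMask
      ⟨inp, out, nn, cl, td, dn, mask.map maskSymbol, u, bin, t, t₁, t₂⟩
      ⟨inp, (maskCode mask).reverse ++ out, nn, cl, td, dn, [], u, bin, t, t₁, t₂⟩
      (mask.length * 5 + 1) := by
  induction mask generalizing out with
  | nil => exact Runs.loop_exit rfl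
  | cons b mask ih =>
    have h₁ : Runs (if some (maskSymbol b) = some (Γ'.bit true) then
          emit [.comma, .bit true, .comma] else emit [.comma, .comma])
        ⟨inp, out, nn, cl, td, dn, mask.map maskSymbol, u, bin, t, t₁, t₂⟩
        ⟨inp, (maskCode [b]).reverse ++ out, nn, cl, td, dn, mask.map maskSymbol, u, bin, t, t₁, t₂⟩
        4 := by
      cases b
      · rw [if_neg (by simp [maskSymbol])]
        exact (runs_emit _ _).mono (by simp)
      · rw [if_pos (by simp [maskSymbol])]
        exact (runs_emit _ _).mono (by simp)
    have h := Runs.loop_step (k := .mk) (c := Option.isSome)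
      (s := ⟨inp, out, nn, cl, td, dn, (b :: mask).map maskSymbol, u, bin, t, t₁, t₂⟩) rfl h₁ (ih _)
    have e : (maskCode (b :: mask)).reverse ++ out =
        (maskCode mask).reverse ++ ((maskCode [b]).reverse ++ out) := by
      rw [← List.append_assoc, ← List.reverse_append]
      simp [maskCode]
    rw [e]
    exact h.mono (by simp only [List.length_cons]; omega)

/-- Move two marks from `td` to `dn` for every mark on `nn`. -/
def shiftMarks : RProg :=
  forEach .nn .t₁ (seq (pop .td fun _ => skip) (seq (pop .td fun _ => skip)
    (seq (push .dn .blank) (push .dn .blank))))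

theorem runs_shiftMarks (inp out cl mk u bin t t₂ : List Γ') (n g r : ℕ) :
    Runs shiftMarks
      ⟨inp, out, marks n, cl, marks (2 * n + r), marks g, mk, u, bin, t, [], t₂⟩
      ⟨inp, out, marks n, cl, marks r, marks (g + 2 * n), mk, u, bin, t, [], t₂⟩
      (10 * n + 2) := by
  have h := runs_forEach (k := .nn) (k' := .t₁) (by decide)
    (p := seq (pop .td fun _ => skip) (seq (pop .td fun _ => skip)
      (seq (push .dn .blank) (push .dn .blank)))) (c := 6) n
    (fun i => ⟨inp, out, [], cl, marks (2 * (n - i) + r), marks (g + 2 * i), mk, u, bin, t, [], t₂⟩)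
    fun i hi => by
      have e : 2 * (n - i) + r = (2 * (n - (i + 1)) + r) + 1 + 1 := by omega
      have hp : ∀ s : St, Runs (pop .td fun _ => skip) s (s.set .td (s.get .td).tail) 2 :=
        fun s => Runs.pop (runs_skip _)
      simp only [e]
      exact (hp _).seq ((hp _).seq ((runs_push _ _ _).seq (runs_push _ _ _)))
  simp only [Nat.sub_zero, Nat.sub_self, Nat.mul_zero, Nat.zero_add, Nat.add_zero] at h
  exact Runs.mono h (by omega)

/-- The code of a clause row with the given mask, after `g` groups and before `r` groups and the
`n` last groups. -/
def clauseRowCode (n g r : ℕ) (mask : List Bool) : List Γ' :=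
  [.bra] ++ zeros g ++ maskCode mask ++ zeros r ++ zeros n ++ [.ket]

/-- Read a clause from the input, after its opening bracket, and write its row. -/
def processClause : RProg :=
  seq (forEach .nn .t₁ (seq (push .mk .blank) (push .mk .blank))) (seq readLiterals
    (seq (emit [.bra]) (seq (emitZeros .dn) (seq emitMask (seq shiftMarks (seq (emitZeros .td)
      (seq (emitZeros .nn) (emit [.ket]))))))))

/-- The marks on `dn` give the zeros before the block. Those on `td` still include the block until
`shiftMarks` has passed it, and only then give the zeros behind it. The last `n` groups are written
separately. -/
theorem runs_processClause {n : ℕ} (out cl rest : List Γ') (C : List (Fin n × Bool)) (g r : ℕ) :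
    Runs processClause
      ⟨literalsCode C ++ Γ'.ket :: rest, out, marks n, cl, marks (2 * n + r), marks g, [], [], [],
        [], [], []⟩
      ⟨rest, (clauseRowCode n g r (clauseMask C)).reverse ++ out, marks n, cl, marks r,
        marks (g + 2 * n), [], [], [], [], [], []⟩
      (C.length * (7 * n ^ 2 + 15 * n + 7) + 33 * n + 7 * g + 7 * r + 20) := by
  have h₁ := runs_forEach (k := .nn) (k' := .t₁) (by decide)
    (p := seq (push .mk .blank) (push .mk .blank)) (c := 2) n
    (fun i => ⟨literalsCode C ++ Γ'.ket :: rest, out, [], cl, marks (2 * n + r), marks g,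
      marks (2 * i), [], [], [], [], []⟩) fun i _ => (runs_push _ _ _).seq (runs_push _ _ _)
  have h₂ := runs_readLiterals out cl (marks (2 * n + r)) (marks g) [] rest C
    (List.replicate (2 * n) false) List.length_replicate
  have e₀ : (List.replicate (2 * n) false).map maskSymbol = marks (2 * n) := by
    rw [List.map_replicate]; rfl
  rw [e₀] at h₂
  have h₃ := runs_emit [.bra] ⟨rest, out, marks n, cl, marks (2 * n + r), marks g,
    (clauseMask C).map maskSymbol, [], [], [], [], []⟩
  have h₄ := runs_emitZeros (k := .dn) (d := g) (s := ⟨rest, [Γ'.bra].reverse ++ out, marks n, cl,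
    marks (2 * n + r), marks g, (clauseMask C).map maskSymbol, [], [], [], [], []⟩) (by decide)
    (by decide) rfl rfl
  have h₅ := runs_emitMask rest (zeros g ++ ([Γ'.bra].reverse ++ out)) (marks n) cl
    (marks (2 * n + r)) (marks g) [] [] [] [] [] (clauseMask C)
  have h₆ := runs_shiftMarks rest
    ((maskCode (clauseMask C)).reverse ++ (zeros g ++ ([Γ'.bra].reverse ++ out))) cl [] [] [] [] []
    n g r
  have h := h₁.seq (h₂.seq (h₃.seq (h₄.seq (h₅.seq (h₆.seq
    ((runs_emitZeros (k := .td) (d := r) (by decide) (by decide) rfl rfl).seq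
    ((runs_emitZeros (k := .nn) (d := n) (by decide) (by decide) rfl rfl).seq
    (runs_emit [.ket] _))))))))
  have e : (clauseRowCode n g r (clauseMask C)).reverse ++ out =
    [Γ'.ket].reverse ++ (zeros n ++ (zeros r ++ ((maskCode (clauseMask C)).reverse ++ (zeros g ++
      ([Γ'.bra].reverse ++ out))))) := by
    simp only [clauseRowCode, List.reverse_append, reverse_zeros, List.append_assoc]
  rw [e]
  refine Runs.mono h ?_
  have : (clauseMask C).length = 2 * n := (length_addMask _ _).trans List.length_replicate
  simp only [List.length_cons, List.length_nil]
  rw [this]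
  omega

/-- The code of a list of clauses. -/
def clausesCode {n : ℕ} (φ : CNFFormula n) : List Γ' :=
  φ.flatMap fun C => [Γ'.bra] ++ literalsCode C ++ [Γ'.ket]

theorem clausesCode_cons {n : ℕ} (C : List (Fin n × Bool)) (φ : CNFFormula n) :
    clausesCode (C :: φ) = Γ'.bra :: (literalsCode C ++ Γ'.ket :: clausesCode φ) := by
  simp [clausesCode]

/-- The code of the clause rows, after `g` groups. -/
def clauseBlockCode {n : ℕ} : ℕ → CNFFormula n → List Γ'
  | _, [] => []
  | g, C :: φ => clauseRowCode n g (φ.length * (2 * n)) (clauseMask C) ++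
      clauseBlockCode (g + 2 * n) φ

/-- Read the clauses from the input and write their rows. -/
def emitClauseRows : RProg := loop .inp Option.isSome fun _ => processClause

/-- The sum `g + φ.length * (2 * n)` does not change from clause to clause, so one bound per clause
serves the whole induction. -/
theorem runs_emitClauseRows {n : ℕ} (out cl : List Γ') (φ : CNFFormula n) (q : ℕ)
    (hφ : φ.IsWidthLE q) (g : ℕ) :
    Runs emitClauseRows
      ⟨clausesCode φ, out, marks n, cl, marks (φ.length * (2 * n)), marks g, [], [], [], [], [], []⟩
      ⟨[], (clauseBlockCode g φ).reverse ++ out, marks n, cl, [], marks (g + φ.length * (2 * n)),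
        [], [], [], [], [], []⟩
      (φ.length * (q * (7 * n ^ 2 + 15 * n + 7) + 33 * n + 7 * (g + φ.length * (2 * n)) + 21) + 1)
      := by
  induction φ generalizing g out with
  | nil =>
    rw [List.length_nil, Nat.zero_mul]
    exact (Runs.loop_exit rfl).mono (by omega)
  | cons C φ ih =>
    have h₁ := runs_processClause out cl (clausesCode φ) C g (φ.length * (2 * n))
    have h₂ := ih ((clauseRowCode n g (φ.length * (2 * n)) (clauseMask C)).reverse ++ out)
      (fun C hC => hφ C (List.mem_cons_of_mem _ hC)) (g + 2 * n)
    have e₂ : (C :: φ).length * (2 * n) = 2 * n + φ.length * (2 * n) := by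
      rw [List.length_cons, Nat.succ_mul, Nat.add_comm]
    have h := Runs.loop_step (k := .inp) (c := Option.isSome) (f := fun _ => processClause)
      (s := ⟨Γ'.bra :: (literalsCode C ++ Γ'.ket :: clausesCode φ), out, marks n, cl,
        marks (2 * n + φ.length * (2 * n)), marks g, [], [], [], [], [], []⟩) rfl h₁ h₂
    rw [clausesCode_cons, e₂, clauseBlockCode, List.reverse_append, List.append_assoc, ← Nat.add_assoc]
    refine Runs.mono h ?_
    have hC : C.length ≤ q := hφ C (List.mem_cons_self)
    have := Nat.mul_le_mul_right (7 * n ^ 2 + 15 * n + 7) hC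
    simp only [List.length_cons]
    nlinarith

end ClauseRows

/-! ### The complete reduction program -/

section Reduction

/-- The code of a vector of `k` ones. -/
def targetCode (k : ℕ) : List Γ' := (List.replicate k [Γ'.bit true, Γ'.comma]).flatten

theorem runs_emitTarget {k : Stk} (hk : k ≠ .out) {s : St} {d : ℕ} (hd : s.get k = marks d) :
    Runs (loop k Option.isSome fun _ => emit [.bit true, .comma]) s
      ((s.set .out ((targetCode d).reverse ++ s.out)).set k []) (4 * d + 1) := by
  have h := Runs.loop_list (k := k) (f := fun _ => emit [.bit true, .comma]) (c := 3) (marks d)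
    (fun i => s.set .out ((targetCode i).reverse ++ s.out)) fun i _ => by
      have e : (targetCode (i + 1)).reverse ++ s.out =
          [Γ'.bit true, Γ'.comma].reverse ++ ((targetCode i).reverse ++ s.out) := by
        simp [targetCode, List.replicate_succ']
      have h := runs_emit [.bit true, .comma] ((s.set .out ((targetCode i).reverse ++ s.out)).set k
        ((marks d).drop (i + 1)))
      rw [e]
      obtain ⟨⟩ := s
      cases k <;> first | exact absurd rfl hk | exact h
  simp only [List.length_replicate] at h
  refine Runs.mono (t := d * (3 + 1) + 1) ?_ (by omega)
  obtain ⟨⟩ := s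
  cases k <;> first | exact absurd rfl hk | (subst hd; exact h)

/-- The reduction. -/
def reduction : RProg :=
  seq (seq readNumber (move .u .nn)) (seq countClauses (seq markPositions (seq emitHeader
    (seq emitChainBlock (seq emitClauseRows
      (seq (seq (emit [.bra]) (seq (loop .dn Option.isSome fun _ => emit [.bit true, .comma])
          (seq (loop .cl Option.isSome fun _ => emit [.bit true, .comma]) (emit [.ket]))))
        (loop .nn Option.isSome fun _ => skip)))))))

/-- The output of the reduction. -/
def reductionCode {n : ℕ} (φ : CNFFormula n) : List Γ' :=
  encodeNumber (φ.length * (2 * n) + φ.length) ++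
    encodeNumber (2 * (φ.length * (2 * n) + n)) ++
    ((List.range (φ.length * (2 * n))).flatMap fun g =>
      chainRowCode (n - 1) g (φ.length * (2 * n) - (g + 1))) ++
    clauseBlockCode 0 φ ++
    [.bra] ++ (targetCode (φ.length * (2 * n)) ++ targetCode φ.length) ++ [.ket]

theorem count_ket_clausesCode {n : ℕ} (φ : CNFFormula n) :
    (clausesCode φ).count .ket = φ.length := by
  have hnum : ∀ x, (encodeNumber x).count Γ'.ket = 0 := by
    intro x
    simp [encodeNumber, List.count_eq_zero]
  have hlit : ∀ C : List (Fin n × Bool), (literalsCode C).count Γ'.ket = 0 := by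
    intro C
    induction C with
    | nil => rfl
    | cons l C ih =>
      simp only [literalsCode, List.flatMap_cons, List.count_append, List.count_cons, hnum] at ih ⊢
      simp [ih]
  induction φ with
  | nil => rfl
  | cons C φ ih =>
    rw [clausesCode_cons]
    simp [hlit, ih]

theorem length_clausesCode_le {n : ℕ} (φ : CNFFormula n) (q : ℕ) (hφ : φ.IsWidthLE q) :
    (clausesCode φ).length ≤ φ.length * (q * (n + 2) + 2) := by
  have hlit : ∀ C : List (Fin n × Bool), (literalsCode C).length ≤ C.length * (n + 2) := by
    intro C
    induction C with
    | nil => simp [literalsCode]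
    | cons l C ih =>
      have := length_encodeNat_le l.1
      have := l.1.2
      simp only [literalsCode, List.flatMap_cons, List.length_append, List.length_cons,
        encodeNumber, List.length_map, List.length_nil, Nat.add_mul] at ih ⊢
      omega
  induction φ with
  | nil => simp [clausesCode]
  | cons C φ ih =>
    have h := ih (fun C hC => hφ C (List.mem_cons_of_mem _ hC))
    have h₁ := hlit C
    have h₂ := Nat.mul_le_mul_right (n + 2) (hφ C List.mem_cons_self)
    rw [clausesCode_cons]
    simp only [List.length_append, List.length_cons, Nat.add_mul] at h h₁ h₂ ⊢
    omega

/-- A bound for the running time of the reduction. -/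
def reductionTime (q n m : ℕ) : ℕ :=
  7 * (n + 1) ^ 2 + (2 * n + 1) + (5 * (m * (q * (n + 2) + 2)) + 2) + (m * (n * 6 + 2 + 4) + 2) +
    80 * (m * (2 * n) + n + m + 1) ^ 2 + (m * (2 * n) * (7 * (n + m * (2 * n)) + 24) + 4) +
    (m * (q * (7 * n ^ 2 + 15 * n + 7) + 33 * n + 7 * (m * (2 * n)) + 21) + 1) +
    (4 * (m * (2 * n)) + 4 * m + 6) + (2 * n + 1)

/-- The width `q` enters because it bounds the length of the input and the work per clause. The
final loop over `nn` discards the last auxiliary marks, leaving only the output. -/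
theorem runs_reduction {n : ℕ} (φ : CNFFormula n) (q : ℕ) (hφ : φ.IsWidthLE q) :
    Runs reduction ⟨φ.encode, [], [], [], [], [], [], [], [], [], [], []⟩
      ⟨[], (reductionCode φ).reverse, [], [], [], [], [], [], [], [], [], []⟩
      (reductionTime q n φ.length) := by
  have e₁ : φ.encode = encodeNumber n ++ clausesCode φ := rfl
  set m := φ.length with hm
  set d := m * (2 * n) with hd
  have h₁ := (runs_readNumber [] [] [] [] [] [] [] [] (clausesCode φ) n).seq
    (runs_move (k := .u) (k' := .nn) (by decide) _)
  simp only [St.get, St.set, List.reverse_replicate, List.append_nil, List.length_replicate] at h₁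
  have h₂ := runs_countClauses [] (marks n) [] [] [] [] [] [] [] (clausesCode φ)
  rw [count_ket_clausesCode, ← hm] at h₂
  have h₃ := runs_markPositions (clausesCode φ) [] [] [] [] [] [] n m
  have h₄ := runs_emitHeader (clausesCode φ) [] [] [] [] [] n m d
  have h₅ := runs_emitChainBlock (clausesCode φ)
    ((encodeNumber (d + m) ++ encodeNumber (2 * (d + n))).reverse ++ []) (marks m) [] [] [] [] []
    n d (by rintro rfl; simp [hd])
  have h₆ := runs_emitClauseRows
    (((List.range d).flatMap fun g => chainRowCode (n - 1) g (d - (g + 1))).reverse ++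
    ((encodeNumber (d + m) ++ encodeNumber (2 * (d + n))).reverse ++ [])) (marks m) φ q hφ 0
  rw [← hm, ← hd] at h₆
  have h₇ := ((runs_emit [.bra] ⟨[], (clauseBlockCode 0 φ).reverse ++
    (((List.range d).flatMap fun g => chainRowCode (n - 1) g (d - (g + 1))).reverse ++
    ((encodeNumber (d + m) ++ encodeNumber (2 * (d + n))).reverse ++ [])), marks n, marks m, [],
    marks (0 + d), [], [], [], [], [], []⟩).seq
    ((runs_emitTarget (k := .dn) (d := 0 + d) (by decide) rfl).seq
    ((runs_emitTarget (k := .cl) (d := m) (by decide) rfl).seq (runs_emit [.ket] _)))).seq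
    (Runs.loop_list (k := .nn) (f := fun _ => skip) (c := 1) (marks n)
      (fun _ => ⟨[], [Γ'.ket].reverse ++ ((targetCode m).reverse ++ ((targetCode (0 + d)).reverse ++
        ([Γ'.bra].reverse ++ ((clauseBlockCode 0 φ).reverse ++
    (((List.range d).flatMap fun g => chainRowCode (n - 1) g (d - (g + 1))).reverse ++
    ((encodeNumber (d + m) ++ encodeNumber (2 * (d + n))).reverse ++ [])))))), marks n, [], [], [],
      [], [], [], [], [], []⟩) fun i _ => runs_skip _)
  have h := h₁.seq (h₂.seq (h₃.seq (h₄.seq (h₅.seq (h₆.seq h₇)))))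
  have e : (reductionCode φ).reverse = [Γ'.ket].reverse ++ ((targetCode m).reverse ++
      ((targetCode (0 + d)).reverse ++ ([Γ'.bra].reverse ++ ((clauseBlockCode 0 φ).reverse ++
    (((List.range d).flatMap fun g => chainRowCode (n - 1) g (d - (g + 1))).reverse ++
    ((encodeNumber (d + m) ++ encodeNumber (2 * (d + n))).reverse ++ [])))))) := by
    rw [Nat.zero_add]
    simp only [reductionCode, List.reverse_append, List.append_assoc, List.append_nil, ← hm, ← hd]
  rw [e₁, e]
  refine Runs.mono h ?_
  have := length_clausesCode_le φ q hφ
  simp only [List.length_cons, List.length_nil, List.length_replicate, reductionTime, ← hm, ← hd,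
    Nat.zero_add] at this ⊢
  omega

end Reduction

end StackProg

/-! ### The integer program and its encoding -/

namespace StackProg

/-- The entry in column `j` of the chain row for the groups `g` and `g + n`. -/
def chainEntry (n g j : ℕ) : ℕ := if j / 2 = g ∨ j / 2 = g + n then 1 else 0

/-- The entry in column `j` of the row for the clause number `k`. -/
def clauseEntry {n : ℕ} (φ : CNFFormula n) (k j : ℕ) : ℕ :=
  if j % 2 = 1 ∧ k * (2 * n) ≤ j / 2 ∧
    (clauseMask (φ.getD k [])).getD (j / 2 - k * (2 * n)) false = true then 1 else 0

/-- The entry in row `i` and column `j` of the constraint matrix for a formula. -/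
def satEntry {n : ℕ} (φ : CNFFormula n) (i j : ℕ) : ℕ :=
  if i < φ.length * (2 * n) then chainEntry n i j else clauseEntry φ (i - φ.length * (2 * n)) j

/-- The instance of (IP) for a formula: the columns form groups of two, each row is a chain row,
which says that the sums over two groups at distance `n` add up to one, or a clause row. -/
def satInstance {n : ℕ} (φ : CNFFormula n) : IPInstance where
  m := φ.length * (2 * n) + φ.length
  n := 2 * (φ.length * (2 * n) + n)
  A := fun i j => satEntry φ i j
  b := fun _ => 1

section Encode

open Computability (Γ')

theorem flatMap_finRange {β : Type*} (N : ℕ) (f : ℕ → List β) :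
    (List.finRange N).flatMap (fun j : Fin N => f (j : ℕ)) = (List.range N).flatMap f := by
  rw [← List.map_coe_finRange_eq_range, List.flatMap_map]

theorem flatMap_range_add {β : Type*} (a b : ℕ) (f : ℕ → List β) :
    (List.range (a + b)).flatMap f =
      (List.range a).flatMap f ++ (List.range b).flatMap fun i => f (a + i) := by
  rw [List.range_add, List.flatMap_append, List.flatMap_map]

theorem flatMap_range_two_mul {β : Type*} (N : ℕ) (f : ℕ → List β) :
    (List.range (2 * N)).flatMap f =
      (List.range N).flatMap fun h => f (2 * h) ++ f (2 * h + 1) := by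
  induction N with
  | zero => rfl
  | succ N ih =>
    rw [Nat.mul_succ, flatMap_range_add, ih, List.range_succ, List.flatMap_append]
    simp [List.range_succ]

theorem flatMap_range_zeros {N : ℕ} {f : ℕ → List Γ'} (hf : ∀ i < N, f i = [.comma, .comma]) :
    (List.range N).flatMap f = zeros N := by
  induction N with
  | zero => rfl
  | succ N ih =>
    rw [List.range_succ, List.flatMap_append, ih fun i hi => hf i (hi.trans N.lt_succ_self),
      List.flatMap_singleton, hf N N.lt_succ_self]
    simp [zeros, Nat.mul_succ, List.replicate_add]

theorem flatMap_range_getD {α β : Type*} (l : List α) (d : α) (f : α → List β) :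
    (List.range l.length).flatMap (fun i => f (l.getD i d)) = l.flatMap f := by
  induction l with
  | nil => rfl
  | cons a l ih =>
    rw [List.length_cons, Nat.add_comm, flatMap_range_add, List.flatMap_cons, ← ih]
    simp [List.range_succ, Nat.add_comm 1]

theorem encodeNumber_one : encodeNumber 1 = [Γ'.bit true, Γ'.comma] := rfl

theorem flatMap_chainEntry {n d g : ℕ} (hn : 0 < n) (hg : g < d) :
    (List.range (2 * (d + n))).flatMap (fun j => encodeNumber (chainEntry n g j)) =
      zeros g ++ ones ++ zeros (n - 1) ++ ones ++ zeros (d - (g + 1)) := by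
  rw [flatMap_range_two_mul, show d + n = g + 1 + (n - 1) + 1 + (d - (g + 1)) by omega,
    flatMap_range_add, flatMap_range_add, flatMap_range_add, flatMap_range_add]
  have e₀ : ∀ h, h ≠ g → h ≠ g + n → encodeNumber (chainEntry n g (2 * h)) ++
      encodeNumber (chainEntry n g (2 * h + 1)) = [.comma, .comma] := by
    intro h h₁ h₂
    rw [chainEntry, chainEntry, if_neg (by omega), if_neg (by omega)]
    rfl
  have e₁ : ∀ h, h = g ∨ h = g + n → encodeNumber (chainEntry n g (2 * h)) ++
      encodeNumber (chainEntry n g (2 * h + 1)) = ones := by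
    intro h h₁
    rw [chainEntry, chainEntry, if_pos (by omega), if_pos (by omega)]
    rfl
  refine congrArg₂ _ (congrArg₂ _ (congrArg₂ _ (congrArg₂ _ ?_ ?_) ?_) ?_) ?_
  · exact flatMap_range_zeros fun i hi => e₀ _ (by omega) (by omega)
  · rw [List.range_one, List.flatMap_singleton, e₁ _ (by omega)]
  · exact flatMap_range_zeros fun i hi => e₀ _ (by omega) (by omega)
  · rw [List.range_one, List.flatMap_singleton, e₁ _ (by omega)]
  · exact flatMap_range_zeros fun i hi => e₀ _ (by omega) (by omega)

theorem flatMap_clauseEntry {n : ℕ} (φ : CNFFormula n) {k : ℕ} (hk : k < φ.length) :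
    (List.range (2 * (φ.length * (2 * n) + n))).flatMap
        (fun j => encodeNumber (clauseEntry φ k j)) =
      zeros (k * (2 * n)) ++ maskCode (clauseMask (φ.getD k [])) ++
        zeros ((φ.length - (k + 1)) * (2 * n)) ++ zeros n := by
  have hlen : (clauseMask (φ.getD k [])).length = 2 * n :=
    (length_addMask _ _).trans List.length_replicate
  have hM : φ.length * (2 * n) + n =
      k * (2 * n) + 2 * n + (φ.length - (k + 1)) * (2 * n) + n := by
    obtain ⟨r, hr⟩ := Nat.exists_eq_add_of_lt hk
    rw [hr, show k + r + 1 - (k + 1) = r by omega]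
    ring
  have e₀ : ∀ h, h < k * (2 * n) ∨ k * (2 * n) + 2 * n ≤ h →
      encodeNumber (clauseEntry φ k (2 * h)) ++ encodeNumber (clauseEntry φ k (2 * h + 1)) =
        [.comma, .comma] := by
    intro h hh
    rw [clauseEntry, clauseEntry, if_neg (by omega), if_neg]
    · rfl
    · rintro ⟨-, h₁, h₂⟩
      -- Behind the block the index exceeds the length `2 * n` of the mask, and the default `false`
      -- makes the entry vanish. Before the block `h₁` fails, so the truncated subtraction does no
      -- harm.
      rw [List.getD_eq_default _ _ (by omega)] at h₂
      exact absurd h₂ (by simp)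
  have e₁ : ∀ i, encodeNumber (clauseEntry φ k (2 * (k * (2 * n) + i))) ++
      encodeNumber (clauseEntry φ k (2 * (k * (2 * n) + i) + 1)) =
      if (clauseMask (φ.getD k [])).getD i false then [.comma, .bit true, .comma]
        else [.comma, .comma] := by
    intro i
    have h₁ : (2 * (k * (2 * n) + i) + 1) / 2 = k * (2 * n) + i := by omega
    rw [clauseEntry, clauseEntry, if_neg (by omega), h₁, Nat.add_sub_cancel_left]
    by_cases h : (clauseMask (φ.getD k [])).getD i false = true
    · rw [if_pos ⟨by omega, by omega, h⟩, if_pos h]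
      rfl
    · rw [if_neg (fun h' => h h'.2.2), if_neg h]
      rfl
  rw [flatMap_range_two_mul, hM, flatMap_range_add, flatMap_range_add, flatMap_range_add]
  refine congrArg₂ _ (congrArg₂ _ (congrArg₂ _ ?_ ?_) ?_) ?_
  · exact flatMap_range_zeros fun i hi => e₀ _ (by omega)
  · simp only [e₁]
    have h := flatMap_range_getD (clauseMask (φ.getD k [])) false fun b : Bool =>
      if b then [Γ'.comma, Γ'.bit true, Γ'.comma] else [Γ'.comma, Γ'.comma]
    rw [hlen] at h
    exact h
  · exact flatMap_range_zeros fun i hi => e₀ _ (by omega)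
  · exact flatMap_range_zeros fun i hi => e₀ _ (by omega)

theorem clauseBlockCode_eq {n : ℕ} (φ : CNFFormula n) (g : ℕ) :
    clauseBlockCode g φ = (List.range φ.length).flatMap fun k =>
      clauseRowCode n (g + k * (2 * n)) ((φ.length - (k + 1)) * (2 * n))
        (clauseMask (φ.getD k [])) := by
  induction φ generalizing g with
  | nil => rfl
  | cons C φ ih =>
    rw [clauseBlockCode, ih, List.length_cons, Nat.add_comm φ.length 1, flatMap_range_add]
    simp only [List.range_one, List.flatMap_singleton]
    congr 1
    · simp
    · congr 1
      funext k
      rw [show 1 + φ.length - (1 + k + 1) = φ.length - (k + 1) by omega,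
        show g + 2 * n + k * (2 * n) = g + (1 + k) * (2 * n) by ring, Nat.add_comm 1 k]
      simp

theorem targetCode_eq (k : ℕ) :
    targetCode k = (List.range k).flatMap fun _ => encodeNumber 1 := by
  induction k with
  | zero => rfl
  | succ k ih =>
    rw [List.range_succ, List.flatMap_append, ← ih, List.flatMap_singleton, encodeNumber_one,
      targetCode, targetCode, List.replicate_succ', List.flatten_append]
    simp

/-- With entries given by functions on `ℕ`, the ranges of rows and columns can be split at arbitrary
places. -/
theorem encode_mk (m N : ℕ) (F : ℕ → ℕ → ℕ) (b : ℕ → ℕ) :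
    IPInstance.encode ⟨m, N, fun i j => F i j, fun i => b i⟩ =
      encodeNumber m ++ encodeNumber N ++
        (List.range m).flatMap (fun i =>
          [Γ'.bra] ++ (List.range N).flatMap (fun j => encodeNumber (F i j)) ++ [Γ'.ket]) ++
        [Γ'.bra] ++ (List.range m).flatMap (fun i => encodeNumber (b i)) ++ [Γ'.ket] := by
  rw [← flatMap_finRange m, ← flatMap_finRange m]
  simp only [← flatMap_finRange N]
  rfl

theorem encode_satInstance {n : ℕ} (φ : CNFFormula n) :
    (satInstance φ).encode = reductionCode φ := by
  refine (encode_mk _ _ (satEntry φ) fun _ => 1).trans ?_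
  set d := φ.length * (2 * n) with hd
  have h₁ : ∀ i, i < d → [Γ'.bra] ++ (List.range (2 * (d + n))).flatMap
        (fun j => encodeNumber (satEntry φ i j)) ++ [Γ'.ket] =
      chainRowCode (n - 1) i (d - (i + 1)) := by
    intro i hi
    have hn : 0 < n := by
      rcases Nat.eq_zero_or_pos n with rfl | h
      · simp [hd] at hi
      · exact h
    simp only [satEntry, if_pos hi, ← hd]
    rw [flatMap_chainEntry hn hi]
    simp only [chainRowCode, List.append_assoc]
  have h₂ : ∀ k, k < φ.length → [Γ'.bra] ++ (List.range (2 * (d + n))).flatMap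
        (fun j => encodeNumber (satEntry φ (d + k) j)) ++ [Γ'.ket] =
      clauseRowCode n (0 + k * (2 * n)) ((φ.length - (k + 1)) * (2 * n))
          (clauseMask (φ.getD k [])) := by
    intro k hk
    have hk' : ¬ d + k < d := by omega
    simp only [satEntry, ← hd, if_neg hk', Nat.add_sub_cancel_left]
    rw [flatMap_clauseEntry φ hk]
    simp only [clauseRowCode, List.append_assoc, Nat.zero_add]
  rw [flatMap_range_add, flatMap_range_add, ← targetCode_eq, ← targetCode_eq,
    List.flatMap_congr fun i hi => h₁ i (List.mem_range.1 hi),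
    List.flatMap_congr fun i hi => h₂ i (List.mem_range.1 hi), ← clauseBlockCode_eq]
  simp only [reductionCode, ← hd, List.append_assoc]

end Encode

end StackProg

namespace StackProg

/-! ### Feasibility is equivalent to satisfiability -/

section Feasible

theorem getD_addMask {n : ℕ} (C : List (Fin n × Bool)) (mask : List Bool)
    (hmask : mask.length = 2 * n) (p : ℕ) :
    (addMask C mask).getD p false = true ↔
      mask.getD p false = true ∨ ∃ l ∈ C, litPos l = p := by
  induction C generalizing mask with
  | nil => simp [addMask]
  | cons l C ih =>
    have h := ih (mask.set (litPos l) true) (by simpa using hmask)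
    have hl := litPos_lt l
    refine h.trans ?_
    have : (mask.set (litPos l) true).getD p false = true ↔
        mask.getD p false = true ∨ litPos l = p := by
      simp only [List.getD_eq_getElem?_getD, List.getElem?_set]
      by_cases hp : litPos l = p
      · subst hp
        simp [hmask, hl]
      · simp [hp]
    rw [this]
    simp only [List.mem_cons, exists_eq_or_imp]
    tauto

theorem getD_clauseMask {n : ℕ} (C : List (Fin n × Bool)) (p : ℕ) :
    (clauseMask C).getD p false = true ↔ ∃ l ∈ C, litPos l = p := by
  rw [clauseMask, getD_addMask _ _ List.length_replicate]
  simp only [List.getD_eq_getElem?_getD, List.getElem?_replicate]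
  split_ifs <;> simp

theorem sum_range_two_mul (N : ℕ) (f : ℕ → ℕ) :
    ∑ j ∈ Finset.range (2 * N), f j = ∑ h ∈ Finset.range N, (f (2 * h) + f (2 * h + 1)) := by
  induction N with
  | zero => rfl
  | succ N ih =>
    rw [Nat.mul_succ, Finset.sum_range_succ, Finset.sum_range_succ, Finset.sum_range_succ, ih]
    ring

theorem sum_chainEntry {n G g : ℕ} (hn : 0 < n) (hg : g + n < G) (x : ℕ → ℕ) :
    ∑ j ∈ Finset.range (2 * G), chainEntry n g j * x j =
      (x (2 * g) + x (2 * g + 1)) + (x (2 * (g + n)) + x (2 * (g + n) + 1)) := by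
  rw [sum_range_two_mul]
  have h : ∀ h, chainEntry n g (2 * h) * x (2 * h) + chainEntry n g (2 * h + 1) * x (2 * h + 1) =
      (if h = g then x (2 * h) + x (2 * h + 1) else 0) +
        if h = g + n then x (2 * h) + x (2 * h + 1) else 0 := by
    intro h
    have h₁ : 2 * h / 2 = h := by omega
    have h₂ : (2 * h + 1) / 2 = h := by omega
    rw [chainEntry, chainEntry, h₁, h₂]
    by_cases e₁ : h = g
    · have e₂ : h ≠ g + n := by omega
      simp [e₁, hn.ne']
    · by_cases e₂ : h = g + n
      · simp [e₂, hn.ne']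
      · simp [e₁, e₂]
  simp only [h]
  rw [Finset.sum_add_distrib, Finset.sum_ite_eq', Finset.sum_ite_eq',
    if_pos (Finset.mem_range.2 (by omega)), if_pos (Finset.mem_range.2 hg)]

theorem sum_clauseEntry {n : ℕ} (φ : CNFFormula n) (G k : ℕ) (x : ℕ → ℕ) :
    ∑ j ∈ Finset.range (2 * G), clauseEntry φ k j * x j =
      ∑ h ∈ Finset.range G, if k * (2 * n) ≤ h ∧
        (∃ l ∈ φ.getD k [], litPos l = h - k * (2 * n)) then x (2 * h + 1) else 0 := by
  rw [sum_range_two_mul]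
  refine Finset.sum_congr rfl fun h _ => ?_
  have h₂ : (2 * h + 1) / 2 = h := by omega
  have h₃ : ¬ (2 * h) % 2 = 1 := by omega
  have h₄ : (2 * h + 1) % 2 = 1 := by omega
  rw [clauseEntry, clauseEntry, h₂, if_neg (fun h' => h₃ h'.1), Nat.zero_mul, Nat.zero_add]
  simp only [h₄, true_and, getD_clauseMask]
  split_ifs <;> simp

theorem feasible_satInstance_iff {n : ℕ} (φ : CNFFormula n) :
    (satInstance φ).Feasible ↔ ∃ x : ℕ → ℕ,
      (∀ g < φ.length * (2 * n),
        (x (2 * g) + x (2 * g + 1)) + (x (2 * (g + n)) + x (2 * (g + n) + 1)) = 1) ∧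
      ∀ k < φ.length, (∑ h ∈ Finset.range (φ.length * (2 * n) + n), if k * (2 * n) ≤ h ∧
        (∃ l ∈ φ.getD k [], litPos l = h - k * (2 * n)) then x (2 * h + 1) else 0) = 1 := by
  set d := φ.length * (2 * n) with hd
  have hn : ∀ g, g < d → 0 < n := by
    intro g hg
    rcases Nat.eq_zero_or_pos n with rfl | h
    · simp [hd] at hg
    · exact h
  have hrow : ∀ (x : ℕ → ℕ) (i : Fin (d + φ.length)),
      (satInstance φ).A.mulVec (fun j => x j) i =
        ∑ j ∈ Finset.range (2 * (d + n)), satEntry φ i j * x j := by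
    intro x i
    exact (Finset.sum_range fun j => satEntry φ i j * x j).symm
  have key : ∀ x : ℕ → ℕ, ((satInstance φ).A.mulVec (fun j => x j) = (satInstance φ).b) ↔
      (∀ g < d, (x (2 * g) + x (2 * g + 1)) + (x (2 * (g + n)) + x (2 * (g + n) + 1)) = 1) ∧
      ∀ k < φ.length, (∑ h ∈ Finset.range (d + n), if k * (2 * n) ≤ h ∧
        (∃ l ∈ φ.getD k [], litPos l = h - k * (2 * n)) then x (2 * h + 1) else 0) = 1 := by
    intro x
    have h₁ : ∀ i, i < d → ∑ j ∈ Finset.range (2 * (d + n)), satEntry φ i j * x j =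
        (x (2 * i) + x (2 * i + 1)) + (x (2 * (i + n)) + x (2 * (i + n) + 1)) := by
      intro i hi
      simp only [satEntry, ← hd, if_pos hi]
      exact sum_chainEntry (hn i hi) (by omega) x
    have h₂ : ∀ k, ∑ j ∈ Finset.range (2 * (d + n)), satEntry φ (d + k) j * x j =
        ∑ h ∈ Finset.range (d + n), if k * (2 * n) ≤ h ∧
          (∃ l ∈ φ.getD k [], litPos l = h - k * (2 * n)) then x (2 * h + 1) else 0 := by
      intro k
      have hk' : ¬ d + k < d := by omega
      simp only [satEntry, ← hd, if_neg hk', Nat.add_sub_cancel_left]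
      exact sum_clauseEntry φ _ k x
    constructor
    · intro h
      refine ⟨fun g hg => ?_, fun k hk => ?_⟩
      · rw [← h₁ g hg, ← hrow x ⟨g, by omega⟩]
        exact congrFun h _
      · rw [← h₂ k, ← hrow x ⟨d + k, by omega⟩]
        exact congrFun h _
    · rintro ⟨ha, hb⟩
      funext i
      refine (hrow x i).trans ?_
      have hi : (i : ℕ) < d + φ.length := i.2
      by_cases hid : (i : ℕ) < d
      · exact (h₁ i hid).trans (ha i hid)
      · obtain ⟨k, hk⟩ := Nat.exists_eq_add_of_le (not_lt.1 hid)
        rw [hk, h₂ k]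
        exact hb k (by omega)
  constructor
  · rintro ⟨x, hx⟩
    set x' : ℕ → ℕ := fun j => if hj : j < (satInstance φ).n then x ⟨j, hj⟩ else 0
    refine ⟨x', (key x').1 ?_⟩
    rw [← hx]
    congr 1
    funext j
    exact dif_pos j.2
  · rintro ⟨x, hx⟩
    exact ⟨fun j => x j, (key x).2 hx⟩

theorem satisfiable_of_feasible {n : ℕ} (φ : CNFFormula n) (h : (satInstance φ).Feasible) :
    φ.Satisfiable := by
  obtain ⟨x, hchain, hclause⟩ := (feasible_satInstance_iff φ).1 h
  set y : ℕ → ℕ := fun h => x (2 * h) + x (2 * h + 1) with hy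
  have hch : ∀ g < φ.length * (2 * n), y g + y (g + n) = 1 := hchain
  have hper : ∀ k < φ.length, ∀ p < 2 * n, y (k * (2 * n) + p) = y p := by
    intro k
    induction k with
    | zero => intro _ p _; rw [Nat.zero_mul, Nat.zero_add]
    | succ k ih =>
      intro hk p hp
      rw [← ih (by omega) p hp]
      have hk' : (k + 1 + 1) * (2 * n) ≤ φ.length * (2 * n) := Nat.mul_le_mul_right _ hk
      rw [Nat.succ_mul, Nat.succ_mul] at hk'
      -- Two consecutive chain equations, at distance `n`, have the middle term in common; their
      -- difference gives the period `2 * n`.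
      have h₁ := hch (k * (2 * n) + p) (by omega)
      have h₂ := hch (k * (2 * n) + p + n) (by omega)
      rw [show (k + 1) * (2 * n) + p = k * (2 * n) + p + n + n by ring]
      omega
  refine ⟨fun w => decide (y (w + n) = 1), fun C hC => ?_⟩
  obtain ⟨k, hk, rfl⟩ := List.getElem_of_mem hC
  have hs := hclause k hk
  have hne : ∑ h ∈ Finset.range (φ.length * (2 * n) + n), (if k * (2 * n) ≤ h ∧
      (∃ l ∈ φ.getD k [], litPos l = h - k * (2 * n)) then x (2 * h + 1) else 0) ≠ 0 := by
    rw [hs]; exact one_ne_zero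
  -- A nonzero second column makes the sum over its group nonzero, and by periodicity this sum is
  -- the value of a literal of the clause.
  obtain ⟨h, -, hh⟩ := Finset.exists_ne_zero_of_sum_ne_zero hne
  obtain ⟨⟨hle, l, hl, hlp⟩, hx⟩ := ite_ne_right_iff.1 hh
  rw [List.getD_eq_getElem _ _ hk] at hl
  refine ⟨l, hl, ?_⟩
  have hlt := litPos_lt l
  have hy₁ : y (litPos l) ≠ 0 := by
    rw [← hper k hk _ hlt, hlp, Nat.add_sub_cancel' hle]
    simp only [hy]
    omega
  -- Since there is a clause, the chain rows `w < n` that tie each variable to its negation are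
  -- present.
  have hd : 2 * n ≤ φ.length * (2 * n) := Nat.le_mul_of_pos_left _ (by omega)
  obtain ⟨w, b⟩ := l
  have hw := w.2
  have hc := hch w (by omega)
  cases b
  · have e : litPos (w, false) = w := if_neg (by simp)
    rw [e] at hy₁
    have hc' : y w + y (w + n) = 1 := hc
    have hf : ¬ y (w + n) = 1 := by omega
    exact decide_eq_false hf
  · have e : litPos (w, true) = w + n := if_pos rfl
    rw [e] at hy₁
    have hc' : y w + y (w + n) = 1 := hc
    have hf : y (w + n) = 1 := by omega
    exact decide_eq_true hf

theorem feasible_of_satisfiable {n : ℕ} (φ : CNFFormula n) (h : φ.Satisfiable) :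
    (satInstance φ).Feasible := by
  obtain ⟨v, hv⟩ := h
  have hv' : ∀ k, ∃ p, k < φ.length → ∃ l ∈ φ.getD k [], litPos l = p ∧ v l.1 = l.2 := by
    intro k
    by_cases hk : k < φ.length
    · obtain ⟨l, hl, hvl⟩ := hv _ (List.getElem_mem hk)
      exact ⟨litPos l, fun _ => ⟨l, by rwa [List.getD_eq_getElem _ _ hk], rfl, hvl⟩⟩
    · exact ⟨0, fun h => absurd h hk⟩
  choose w hw using hv'
  -- The truth value of the literal at position `p`: negated variables for `p < n`, variables from
  -- `n` on.
  set val : ℕ → ℕ := fun p => if hp : p < n then (!v ⟨p, hp⟩).toNat else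
    if hp : p - n < n then (v ⟨p - n, hp⟩).toNat else 0 with hval
  have hval_lit : ∀ l : Fin n × Bool, v l.1 = l.2 → val (litPos l) = 1 := by
    rintro ⟨u, b⟩ hu
    have hun := u.2
    cases b
    · have e : litPos (u, false) = u := if_neg (by simp)
      rw [e]
      simp only [hval]
      rw [dif_pos hun]
      simp only [Fin.eta]
      rw [show v u = false from hu]
      rfl
    · have e : litPos (u, true) = u + n := if_pos rfl
      rw [e]
      simp only [hval]
      rw [dif_neg (by omega), dif_pos (by omega)]
      simp only [Nat.add_sub_cancel, Fin.eta]
      rw [show v u = true from hu]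
      rfl
  have hval_add : ∀ p < n, val p + val (p + n) = 1 := by
    intro p hp
    simp only [hval]
    rw [dif_pos hp, dif_neg (by omega), dif_pos (by omega)]
    simp only [Nat.add_sub_cancel]
    cases v ⟨p, hp⟩ <;> rfl
  -- The indicator of the literal chosen in each block. The bound on the block number excludes the
  -- last `n` groups, which belong to no clause and where `w` is arbitrary.
  set star : ℕ → ℕ := fun h =>
    if h / (2 * n) < φ.length ∧ h % (2 * n) = w (h / (2 * n)) then 1 else 0 with hstar
  have hstar_le : ∀ h, star h ≤ val (h % (2 * n)) := by
    intro h
    simp only [hstar]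
    split_ifs with hh
    · obtain ⟨l, -, hlp, hvl⟩ := hw _ hh.1
      rw [hh.2, ← hlp, hval_lit l hvl]
    · exact Nat.zero_le _
  -- The second column of a group carries the choice and the first fills the group up to the value
  -- of its literal. By `hstar_le` the subtraction is not truncated.
  set x : ℕ → ℕ := fun j => if j % 2 = 1 then star (j / 2) else
    val (j / 2 % (2 * n)) - star (j / 2) with hx
  have hx₁ : ∀ h, x (2 * h + 1) = star h := by
    intro h
    simp only [hx]
    rw [if_pos (by omega), show (2 * h + 1) / 2 = h by omega]
  have hx₂ : ∀ h, x (2 * h) + x (2 * h + 1) = val (h % (2 * n)) := by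
    intro h
    rw [hx₁]
    simp only [hx]
    rw [if_neg (by omega), show 2 * h / 2 = h by omega]
    have := hstar_le h
    omega
  refine (feasible_satInstance_iff φ).2 ⟨x, fun g hg => ?_, fun k hk => ?_⟩
  · have hn : 0 < n := by
      rcases Nat.eq_zero_or_pos n with rfl | h
      · simp at hg
      · exact h
    rw [hx₂, hx₂]
    have hlt := Nat.mod_lt g (show 2 * n > 0 by omega)
    by_cases hgn : g % (2 * n) < n
    · rw [Nat.add_mod, Nat.mod_eq_of_lt (show n < 2 * n by omega),
        Nat.mod_eq_of_lt (show g % (2 * n) + n < 2 * n by omega)]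
      exact hval_add _ hgn
    · have e : (g + n) % (2 * n) = g % (2 * n) - n := by
        rw [Nat.add_mod, Nat.mod_eq_of_lt (show n < 2 * n by omega),
          show g % (2 * n) + n = (g % (2 * n) - n) + 2 * n by omega, Nat.add_mod_right,
          Nat.mod_eq_of_lt (by omega)]
      rw [e, Nat.add_comm]
      have := hval_add (g % (2 * n) - n) (by omega)
      rwa [Nat.sub_add_cancel (by omega)] at this
  · obtain ⟨l, hl, hlp, -⟩ := hw k hk
    have hwlt : w k < 2 * n := hlp ▸ litPos_lt l
    have hdiv : (k * (2 * n) + w k) / (2 * n) = k := by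
      rw [Nat.mul_comm, Nat.mul_add_div (by omega), Nat.div_eq_of_lt hwlt, Nat.add_zero]
    have hmod : (k * (2 * n) + w k) % (2 * n) = w k := by
      rw [Nat.mul_comm, Nat.mul_add_mod, Nat.mod_eq_of_lt hwlt]
    rw [Finset.sum_eq_single (k * (2 * n) + w k)]
    · rw [if_pos ⟨by omega, l, hl, by omega⟩, hx₁]
      simp only [hstar]
      rw [hdiv, hmod, if_pos ⟨hk, rfl⟩]
    · intro h _ hne
      split_ifs with hh
      · rw [hx₁]
        simp only [hstar]
        rw [if_neg]
        rintro ⟨-, h₂⟩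
        obtain ⟨hle, l', -, hlp'⟩ := hh
        have hlt' := litPos_lt l'
        have hk' : h / (2 * n) = k := by
          rw [← Nat.add_sub_cancel' hle, Nat.mul_comm, Nat.mul_add_div (by omega),
            Nat.div_eq_of_lt (by rw [Nat.mul_comm]; omega), Nat.add_zero]
        rw [hk'] at h₂
        apply hne
        rw [← h₂, ← hk', Nat.mul_comm, Nat.div_add_mod]
      · rfl
    · intro hnot
      exfalso
      apply hnot
      rw [Finset.mem_range]
      have := Nat.mul_le_mul_right (2 * n) (show k + 1 ≤ φ.length from hk)
      rw [Nat.succ_mul] at this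
      omega

theorem feasible_satInstance {n : ℕ} (φ : CNFFormula n) :
    (satInstance φ).Feasible ↔ φ.Satisfiable :=
  ⟨satisfiable_of_feasible φ, feasible_of_satisfiable φ⟩

end Feasible

end StackProg

/-! ### Connectivity of column matroids -/

section ColumnMatroid

variable {ι κ : Type*} [Finite κ]

theorem Matrix.columnMatroid_indep_iff (A : Matrix ι κ ℝ) (I : Set κ) :
    A.columnMatroid.Indep I ↔ LinearIndepOn ℝ A.col I := by
  simp [Matrix.columnMatroid]

theorem Matrix.columnMatroid_ground (A : Matrix ι κ ℝ) : A.columnMatroid.E = Set.univ := rfl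

/-- A matroid basis of `X` is a maximal independent set of columns in `X`, so it spans the same
subspace. -/
theorem Matrix.toNat_eRk_columnMatroid (A : Matrix ι κ ℝ) (X : Set κ) :
    (A.columnMatroid.eRk X).toNat = Module.finrank ℝ (Submodule.span ℝ (A.col '' X)) := by
  obtain ⟨I, hI⟩ := A.columnMatroid.exists_isBasis X (Set.subset_univ _)
  have hind := (A.columnMatroid_indep_iff I).1 hI.indep
  have hspan : Submodule.span ℝ (A.col '' X) = Submodule.span ℝ (A.col '' I) := by
    refine le_antisymm (Submodule.span_le.2 ?_) (Submodule.span_mono (Set.image_mono hI.subset))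
    rintro _ ⟨e, he, rfl⟩
    by_cases heI : e ∈ I
    · exact Submodule.subset_span ⟨e, heI, rfl⟩
    · by_contra hnot
      refine heI ?_
      have h := hI.eq_of_subset_indep ((A.columnMatroid_indep_iff _).2 (hind.insert hnot))
        (Set.subset_insert e I) (Set.insert_subset he hI.subset)
      rw [h]
      exact Set.mem_insert e I
  have := Fintype.ofFinite I
  rw [← hI.encard_eq_eRk, hspan, Set.image_eq_range, finrank_span_eq_card hind,
    ← Nat.card_eq_fintype_card, Nat.card_coe_set_eq]
  rfl

/-- Restriction to the coordinates in `R` is injective on `V`. -/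
theorem finrank_le_of_support {V : Submodule ℝ (ι → ℝ)} (R : Finset ι)
    (hV : ∀ x ∈ V, ∀ i ∉ R, x i = 0) : Module.finrank ℝ V ≤ R.card := by
  let f : V →ₗ[ℝ] (R → ℝ) :=
    (LinearMap.funLeft ℝ ℝ (Subtype.val : R → ι)).comp V.subtype
  have hf : Function.Injective f := by
    rw [← LinearMap.ker_eq_bot, LinearMap.ker_eq_bot']
    rintro ⟨x, hx⟩ h0
    ext i
    by_cases hi : i ∈ R
    · exact congrFun h0 ⟨i, hi⟩
    · exact hV x hx i hi
  have := LinearMap.finrank_le_finrank_of_injective hf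
  simpa using this

/-- By the dimension formula the connectivity is one more than the dimension of the intersection of
the spans of `X` and its complement. A row that vanishes on one side vanishes on the span of that
side, hence on the intersection, which is therefore supported on `R`. -/
theorem Matrix.connectivity_columnMatroid_le (A : Matrix ι κ ℝ) (X : Set κ) (R : Finset ι)
    (hR : ∀ i ∉ R, (∀ j ∈ X, A i j = 0) ∨ ∀ j ∉ X, A i j = 0) :
    A.columnMatroid.connectivity X ≤ R.card + 1 := by
  have hfin : ∀ Y : Set κ, FiniteDimensional ℝ (Submodule.span ℝ (A.col '' Y)) := fun Y =>
    FiniteDimensional.span_of_finite ℝ (Set.toFinite _)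
  have hX := hfin X
  have hY := hfin Xᶜ
  have hsupp : ∀ (Y : Set κ) (i : ι), (∀ j ∈ Y, A i j = 0) →
      ∀ x ∈ Submodule.span ℝ (A.col '' Y), x i = 0 := by
    intro Y i hi x hx
    have : Submodule.span ℝ (A.col '' Y) ≤ LinearMap.ker (LinearMap.proj (R := ℝ)
        (φ := fun _ : ι => ℝ) i) := by
      rw [Submodule.span_le]
      rintro _ ⟨j, hj, rfl⟩
      exact hi j hj
    exact this hx
  have hinf := finrank_le_of_support
    (V := Submodule.span ℝ (A.col '' X) ⊓ Submodule.span ℝ (A.col '' Xᶜ)) R (by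
      rintro x ⟨h₁, h₂⟩ i hi
      rcases hR i hi with h | h
      · exact hsupp X i h x h₁
      · exact hsupp Xᶜ i h x h₂)
  have hsum := Submodule.finrank_sup_add_finrank_inf_eq
    (Submodule.span ℝ (A.col '' X)) (Submodule.span ℝ (A.col '' Xᶜ))
  rw [← Submodule.span_union, ← Set.image_union, Set.union_compl_self] at hsum
  unfold Matroid.connectivity
  rw [A.columnMatroid_ground, ← Set.compl_eq_univ_sdiff, A.toNat_eRk_columnMatroid,
    A.toNat_eRk_columnMatroid, A.toNat_eRk_columnMatroid]
  omega

end ColumnMatroid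

/-! ### Symmetry of connectivity, and single elements -/

namespace Matroid

variable {α : Type*} (M : Matroid α)

theorem connectivity_diff {X : Set α} (hX : X ⊆ M.E) :
    M.connectivity (M.E \ X) = M.connectivity X := by
  unfold connectivity
  rw [Set.sdiff_sdiff_cancel_left hX, Nat.add_comm (M.eRk X).toNat]

theorem connectivity_singleton_le [Finite α] (x : α) : M.connectivity {x} ≤ 2 := by
  have hfin : ∀ X : Set α, M.eRk X ≠ ⊤ := fun X =>
    ne_top_of_le_ne_top (Set.encard_ne_top_iff.2 (Set.toFinite X)) (M.eRk_le_encard X)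
  have h₁ : (M.eRk {x}).toNat ≤ 1 := by
    have h := ENat.toNat_le_toNat (M.eRk_le_encard {x}) (by simp)
    simpa using h
  have h₂ : (M.eRk (M.E \ {x})).toNat ≤ (M.eRk M.E).toNat :=
    ENat.toNat_le_toNat (M.eRk_mono Set.sdiff_subset) (hfin _)
  unfold connectivity
  omega

end Matroid

/-! ### Caterpillars and their edge cuts -/

namespace SimpleGraph

variable {V : Type*} {G : SimpleGraph V}

/-- If `s(u, v)` is the only edge that leaves the set `C`, then deleting it does not disconnect
`C`. -/
theorem reachable_deleteEdges_iff_mem (hG : G.Preconnected) {u v : V} {C : Set V} (hu : u ∈ C)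
    (hv : v ∉ C) (hC : ∀ a b, G.Adj a b → a ∈ C → b ∉ C → a = u ∧ b = v) (x : V) :
    (G.deleteEdges {s(u, v)}).Reachable u x ↔ x ∈ C := by
  set H := G.deleteEdges {s(u, v)} with hH
  have hadj : ∀ a b, H.Adj a b → (a ∈ C ↔ b ∈ C) := by
    intro a b hab
    rw [hH, deleteEdges_adj] at hab
    obtain ⟨hab, hne⟩ := hab
    constructor
    · intro ha
      by_contra hb
      obtain ⟨rfl, rfl⟩ := hC a b hab ha hb
      exact hne rfl
    · intro hb
      by_contra ha
      obtain ⟨rfl, rfl⟩ := hC b a hab.symm hb ha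
      exact hne Sym2.eq_swap
  have hreach : ∀ a b, H.Reachable a b → (a ∈ C ↔ b ∈ C) := by
    rintro a b ⟨p⟩
    induction p with
    | nil => exact Iff.rfl
    | cons h _ ih => exact (hadj _ _ h).trans ih
  refine ⟨fun h => (hreach _ _ h).1 hu, fun hx => ?_⟩
  -- Along a walk of `G` every vertex stays connected in `H` to `u` or to `v`, because crossing the
  -- deleted edge leads to one of these. For a vertex of `C` it must be `u`, since `H` has no edge
  -- between `C` and its complement.
  have hor : ∀ a b, G.Walk a b → (H.Reachable u a ∨ H.Reachable v a) →
      (H.Reachable u b ∨ H.Reachable v b) := by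
    intro a b p
    induction p with
    | nil => exact id
    | @cons a c b h _ ih =>
      intro ha
      apply ih
      by_cases he : s(a, c) = s(u, v)
      · rcases Sym2.eq_iff.1 he with ⟨-, rfl⟩ | ⟨-, rfl⟩
        · exact .inr (Reachable.refl _)
        · exact .inl (Reachable.refl _)
      · have hac : H.Adj a c := by
          rw [hH, deleteEdges_adj]
          exact ⟨h, he⟩
        exact ha.imp (fun h' => h'.trans hac.reachable) fun h' => h'.trans hac.reachable
  obtain ⟨p⟩ := hG u x
  refine (hor _ _ p (.inl (Reachable.refl _))).resolve_right fun h => ?_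
  exact hv ((hreach _ _ h).2 hx)

/-- The caterpillar that consists of a path with `p + 2` vertices and a pendant vertex at each of
its inner vertices. -/
def caterpillar (p : ℕ) : SimpleGraph (Fin (p + 2) ⊕ Fin p) where
  Adj
    | .inl i, .inl j => (i : ℕ) + 1 = j ∨ (j : ℕ) + 1 = i
    | .inl i, .inr j => (i : ℕ) = j + 1
    | .inr j, .inl i => (i : ℕ) = j + 1
    | .inr _, .inr _ => False
  symm := ⟨by
    rintro (i | i) (j | j) h
    · exact h.symm
    · exact h
    · exact h
    · exact h⟩
  loopless := ⟨by
    rintro (i | i) h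
    · rcases h with h | h <;> omega
    · exact h⟩

namespace caterpillar

variable {p : ℕ}

theorem exists_path (i : ℕ) (hi : i < p + 2) :
    ∃ w : (caterpillar p).Walk (.inl 0) (.inl ⟨i, hi⟩), w.IsPath ∧
      ∀ j : Fin (p + 2), .inl j ∈ w.support ↔ (j : ℕ) ≤ i := by
  induction i with
  | zero =>
    refine ⟨Walk.nil, Walk.IsPath.nil, fun j => ?_⟩
    refine List.mem_singleton.trans ?_
    simp only [Sum.inl.injEq, Fin.ext_iff, Fin.val_zero]
    omega
  | succ i ih =>
    obtain ⟨w, hw, hs⟩ := ih (by omega)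
    have hadj : (caterpillar p).Adj (.inl ⟨i, by omega⟩) (.inl ⟨i + 1, hi⟩) := Or.inl rfl
    refine ⟨w.concat hadj, hw.concat (fun h => ?_) hadj, fun j => ?_⟩
    · have := (hs ⟨i + 1, hi⟩).1 h
      simp at this
    · simp only [Walk.support_concat, List.mem_append, List.mem_singleton,
        Sum.inl.injEq, Fin.ext_iff, hs]
      omega

theorem preconnected : (caterpillar p).Preconnected := by
  have h : ∀ x, (caterpillar p).Reachable (.inl 0) x := by
    rintro (i | j)
    · exact ⟨(exists_path i i.2).choose⟩
    · obtain ⟨w, -⟩ := exists_path (p := p) (j + 1) (by omega)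
      have hadj : (caterpillar p).Adj (.inl ⟨j + 1, by omega⟩) (.inr j) := rfl
      exact ⟨w.concat hadj⟩
  exact fun x y => (h x).symm.trans (h y)

/-- The place of a vertex along the path. -/
def pos : Fin (p + 2) ⊕ Fin p → ℕ
  | .inl i => i
  | .inr j => j + 1

/-- A pendant vertex has the same `pos` as its neighbour on the path, so this edge is the only one
that leaves the set of vertices with `pos` at most `i`. -/
theorem reachable_path_iff {i j : Fin (p + 2)} (hij : (i : ℕ) + 1 = j)
    (x : Fin (p + 2) ⊕ Fin p) :
    ((caterpillar p).deleteEdges {s(.inl i, .inl j)}).Reachable (.inl i) x ↔ pos x ≤ i := by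
  refine reachable_deleteEdges_iff_mem (C := {x | pos x ≤ i}) preconnected (by simp [pos])
    (by simp [pos]; omega) ?_ x
  rintro (a | a) (b | b) hab ha hb <;> simp only [caterpillar, Set.mem_ofPred_eq, pos] at hab ha hb
  · simp only [Sum.inl.injEq, Fin.ext_iff]
    omega
  all_goals omega

theorem reachable_path_iff' {i j : Fin (p + 2)} (hij : (i : ℕ) + 1 = j)
    (x : Fin (p + 2) ⊕ Fin p) :
    ((caterpillar p).deleteEdges {s(.inl j, .inl i)}).Reachable (.inl j) x ↔ ¬ pos x ≤ i := by
  refine reachable_deleteEdges_iff_mem (C := {x | ¬ pos x ≤ i}) preconnected (by simp [pos]; omega)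
    (by simp [pos]) ?_ x
  rintro (a | a) (b | b) hab ha hb <;> simp only [caterpillar, Set.mem_ofPred_eq, pos] at hab ha hb
  · simp only [Sum.inl.injEq, Fin.ext_iff]
    omega
  all_goals omega

theorem reachable_pendant_iff {i : Fin (p + 2)} {j : Fin p} (hij : (i : ℕ) = j + 1)
    (x : Fin (p + 2) ⊕ Fin p) :
    ((caterpillar p).deleteEdges {s(.inr j, .inl i)}).Reachable (.inr j) x ↔ x = .inr j := by
  refine reachable_deleteEdges_iff_mem (C := {x | x = .inr j}) preconnected (by simp) (by simp) ?_ x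
  rintro (a | a) (b | b) hab ha hb <;> simp only [caterpillar, Set.mem_ofPred_eq] at hab ha hb
  · simp at ha
  · simp at ha
  · obtain rfl : a = j := by simpa using ha
    refine ⟨rfl, ?_⟩
    simp only [Sum.inl.injEq, Fin.ext_iff]
    omega

theorem reachable_pendant_iff' {i : Fin (p + 2)} {j : Fin p} (hij : (i : ℕ) = j + 1)
    (x : Fin (p + 2) ⊕ Fin p) :
    ((caterpillar p).deleteEdges {s(.inl i, .inr j)}).Reachable (.inl i) x ↔ x ≠ .inr j := by
  refine reachable_deleteEdges_iff_mem (C := {x | x ≠ .inr j}) preconnected (by simp) (by simp) ?_ x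
  rintro (a | a) (b | b) hab ha hb <;>
    simp only [caterpillar, Set.mem_ofPred_eq, not_not] at hab ha hb
  · simp at hb
  · obtain rfl : b = j := by simpa using hb
    refine ⟨?_, rfl⟩
    simp only [Sum.inl.injEq, Fin.ext_iff]
    omega
  · simp at hb

/-- Every edge is a bridge: the descriptions of the components show that its other end is not
reached after the deletion. -/
theorem isTree : (caterpillar p).IsTree := by
  have : Nonempty (Fin (p + 2) ⊕ Fin p) := ⟨.inl 0⟩
  refine ⟨⟨preconnected⟩, isAcyclic_iff_forall_adj_isBridge.2 ?_⟩
  rintro (a | a) (b | b) hab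
  · rcases hab with h | h
    · rw [isBridge_iff, reachable_path_iff h]
      simp [pos]; omega
    · rw [isBridge_iff, reachable_path_iff' h]
      simp [pos]
  · rw [isBridge_iff, reachable_pendant_iff' hab]
    simp
  · rw [isBridge_iff, reachable_pendant_iff hab]
    simp
  · exact hab.elim

theorem neighborSet_inr (j : Fin p) :
    (caterpillar p).neighborSet (.inr j) = {.inl ⟨j + 1, by omega⟩} := by
  ext (x | x)
  · simp only [mem_neighborSet, caterpillar, Set.mem_singleton_iff, Sum.inl.injEq, Fin.ext_iff]
  · simp [caterpillar]

theorem neighborSet_zero :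
    (caterpillar p).neighborSet (.inl 0) = {.inl ⟨1, by omega⟩} := by
  ext (x | x)
  · simp only [mem_neighborSet, caterpillar, Set.mem_singleton_iff, Sum.inl.injEq, Fin.ext_iff,
      Fin.val_zero]
    omega
  · simp [caterpillar]

theorem neighborSet_last :
    (caterpillar p).neighborSet (.inl ⟨p + 1, by omega⟩) = {.inl ⟨p, by omega⟩} := by
  ext (x | x)
  · simp only [mem_neighborSet, caterpillar, Set.mem_singleton_iff, Sum.inl.injEq, Fin.ext_iff]
    omega
  · simp only [mem_neighborSet, caterpillar, Set.mem_singleton_iff, reduceCtorEq, iff_false]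
    omega

theorem neighborSet_inner (j : Fin p) :
    (caterpillar p).neighborSet (.inl ⟨j + 1, by omega⟩) =
      {.inl ⟨j, by omega⟩, .inl ⟨j + 2, by omega⟩, .inr j} := by
  ext (x | x)
  · simp only [mem_neighborSet, caterpillar, Set.mem_insert_iff, Set.mem_singleton_iff,
      Sum.inl.injEq, Fin.ext_iff, reduceCtorEq, or_false]
    omega
  · simp only [mem_neighborSet, caterpillar, Set.mem_insert_iff, Set.mem_singleton_iff,
      Sum.inr.injEq, Fin.ext_iff, reduceCtorEq, false_or]
    omega

theorem ncard_neighborSet_inner (j : Fin p) :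
    ((caterpillar p).neighborSet (.inl ⟨j + 1, by omega⟩)).ncard = 3 := by
  rw [neighborSet_inner, Set.ncard_eq_three]
  refine ⟨_, _, _, ?_, ?_, ?_, rfl⟩ <;> simp

/-- The leaves of the caterpillar, in the order along its path. -/
def leafVertex (i : Fin (p + 2)) : Fin (p + 2) ⊕ Fin p :=
  if h : 0 < (i : ℕ) ∧ (i : ℕ) < p + 1 then .inr ⟨i - 1, by omega⟩ else .inl i

theorem pos_leafVertex (i : Fin (p + 2)) : pos (leafVertex i) = i := by
  unfold leafVertex
  split_ifs with h
  · simp only [pos]; omega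
  · rfl

theorem ncard_neighborSet_leafVertex (i : Fin (p + 2)) :
    ((caterpillar p).neighborSet (leafVertex i)).ncard ≤ 1 := by
  unfold leafVertex
  split_ifs with h
  · rw [neighborSet_inr, Set.ncard_singleton]
  · rcases Nat.eq_zero_or_pos (i : ℕ) with h₀ | h₀
    · obtain rfl : i = 0 := Fin.ext h₀
      rw [neighborSet_zero, Set.ncard_singleton]
    · have e : i = ⟨p + 1, by omega⟩ := Fin.ext (by simp; omega)
      rw [e, neighborSet_last, Set.ncard_singleton]

/-- With `≠ 3` in place of `≤ 1` this gives both the degree condition of a branch decomposition and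
the surjectivity onto the leaves. -/
theorem exists_leafVertex_eq {v : Fin (p + 2) ⊕ Fin p}
    (hv : ((caterpillar p).neighborSet v).ncard ≠ 3) : ∃ i, leafVertex i = v := by
  rcases v with i | j
  · refine ⟨i, dif_neg fun h => hv ?_⟩
    have := ncard_neighborSet_inner (p := p) ⟨i - 1, by omega⟩
    have e : (⟨(i : ℕ) - 1 + 1, by omega⟩ : Fin (p + 2)) = i := Fin.ext (by simp; omega)
    simpa only [e] using this
  · refine ⟨⟨j + 1, by omega⟩, ?_⟩
    unfold leafVertex
    rw [dif_pos ⟨by simp, by simp⟩]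
    simp

theorem leafVertex_eq_inr_iff (i : Fin (p + 2)) (j : Fin p) :
    leafVertex i = .inr j ↔ i = ⟨j + 1, by omega⟩ := by
  constructor
  · intro h
    have := pos_leafVertex i
    rw [h] at this
    exact Fin.ext this.symm
  · rintro rfl
    unfold leafVertex
    rw [dif_pos ⟨by simp, by simp⟩]
    simp

end caterpillar

end SimpleGraph

/-! ### Path-width from a linear order of the elements -/

namespace Matroid

open SimpleGraph

/-- The branch decomposition along the caterpillar, for a matroid with elements `0, …, p + 1`. -/
noncomputable def caterpillarDecomposition {p : ℕ} (M : Matroid (Fin (p + 2)))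
    (hE : M.E = Set.univ) : M.BranchDecomposition where
  V := Fin (p + 2) ⊕ Fin p
  finite_V := inferInstance
  T := caterpillar p
  isTree := caterpillar.isTree
  cubic := fun v => by
    by_cases h : ((caterpillar p).neighborSet v).ncard = 3
    · exact .inr h
    · obtain ⟨i, rfl⟩ := caterpillar.exists_leafVertex_eq h
      exact .inl (caterpillar.ncard_neighborSet_leafVertex i)
  leaf := (Equiv.setCongr hE).trans <| (Equiv.Set.univ _).trans <|
    Equiv.ofBijective
      (fun i => ⟨caterpillar.leafVertex i, caterpillar.ncard_neighborSet_leafVertex i⟩)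
      ⟨fun i j h => Fin.ext (by
        rw [← caterpillar.pos_leafVertex i, ← caterpillar.pos_leafVertex j]
        exact congrArg (fun v => caterpillar.pos v.1) h),
      fun ⟨v, hv⟩ => by
        obtain ⟨i, hi⟩ := caterpillar.exists_leafVertex_eq (v := v) (by omega)
        exact ⟨i, Subtype.ext hi⟩⟩

theorem isCaterpillar_caterpillarDecomposition {p : ℕ} (M : Matroid (Fin (p + 2)))
    (hE : M.E = Set.univ) : (M.caterpillarDecomposition hE).IsCaterpillar := by
  obtain ⟨w, hw, hs⟩ := caterpillar.exists_path (p := p) (p + 1) (by omega)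
  refine ⟨_, _, w, hw, ?_⟩
  rintro (i | j) hy
  · exact absurd ((hs i).2 (by omega)) hy
  · exact ⟨_, (hs _).2 (by simp), caterpillar.neighborSet_inr j⟩

/-- An edge of the path separates an initial segment of the elements from the rest, and a pendant
edge separates a single element, whose connectivity is at most `2`. -/
theorem pathWidth_le_of_connectivity_le {N : ℕ} (hN : 2 ≤ N) (M : Matroid (Fin N))
    (hE : M.E = Set.univ) {w : ℕ} (hw : 2 ≤ w)
    (h : ∀ c : ℕ, M.connectivity {j | (j : ℕ) < c} ≤ w) : M.pathWidth ≤ w := by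
  obtain ⟨p, rfl⟩ := Nat.exists_eq_add_of_le' hN
  refine Nat.sInf_le ⟨M.caterpillarDecomposition hE,
    M.isCaterpillar_caterpillarDecomposition hE, ?_⟩
  have hside : ∀ u v : Fin (p + 2) ⊕ Fin p, (M.caterpillarDecomposition hE).side u v =
      {i | ((caterpillar p).deleteEdges {s(u, v)}).Reachable u (caterpillar.leafVertex i)} := by
    intro u v
    ext i
    exact ⟨fun ⟨_, hi⟩ => hi, fun hi => ⟨hE ▸ Set.mem_univ i, hi⟩⟩
  have hcompl : ∀ X : Set (Fin (p + 2)), M.connectivity Xᶜ = M.connectivity X := by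
    intro X
    have := M.connectivity_diff (X := X) (hE ▸ Set.subset_univ X)
    rwa [hE, ← Set.compl_eq_univ_sdiff] at this
  have key : ∀ u v : Fin (p + 2) ⊕ Fin p, (caterpillar p).Adj u v → M.connectivity
      {i | ((caterpillar p).deleteEdges {s(u, v)}).Reachable u (caterpillar.leafVertex i)} ≤ w := by
    rintro (a | a) (b | b) huv
    · rcases huv with hab | hab
      · simp only [caterpillar.reachable_path_iff hab, caterpillar.pos_leafVertex]
        simpa only [Nat.lt_succ_iff] using h (a + 1)
      · simp only [caterpillar.reachable_path_iff' hab, caterpillar.pos_leafVertex]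
        have := h (b + 1)
        rw [← hcompl] at this
        simp only [Nat.lt_succ_iff] at this
        exact this
    · simp only [caterpillar.reachable_pendant_iff' huv, Ne, caterpillar.leafVertex_eq_inr_iff]
      have := M.connectivity_singleton_le (⟨b + 1, by omega⟩ : Fin (p + 2))
      rw [← hcompl] at this
      exact this.trans hw
    · simp only [caterpillar.reachable_pendant_iff huv, caterpillar.leafVertex_eq_inr_iff]
      exact (M.connectivity_singleton_le _).trans hw
    · exact huv.elim
  intro u v huv
  exact (congrArg M.connectivity (hside u v)).trans_le (key u v huv)

end Matroid

/-! ### Parameters of the constructed instance -/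

namespace StackProg

theorem maxTarget_satInstance_le {n : ℕ} (φ : CNFFormula n) : (satInstance φ).maxTarget ≤ 1 :=
  Finset.sup_le fun _ _ => le_rfl

theorem maxTarget_satInstance {n : ℕ} (φ : CNFFormula n) (hφ : φ.length ≠ 0) :
    (satInstance φ).maxTarget = 1 := by
  refine le_antisymm (maxTarget_satInstance_le φ) ?_
  exact Finset.le_sup (f := (satInstance φ).b)
    (Finset.mem_univ (⟨0, by simp only [satInstance]; omega⟩ : Fin (satInstance φ).m))

theorem maxTarget_satInstance_nil {n : ℕ} (φ : CNFFormula n) (hφ : φ.length = 0) :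
    (satInstance φ).maxTarget = 0 := by
  refine Nat.le_zero.1 (Finset.sup_le fun i _ => ?_)
  have : (i : ℕ) < φ.length * (2 * n) + φ.length := i.2
  rw [hφ] at this
  omega

/-- The rows that may have entries on both sides of column `c`. -/
noncomputable def crossingRows {n : ℕ} (φ : CNFFormula n) (c : ℕ) : Finset (Fin (satInstance φ).m) :=
  Finset.univ.filter fun i => (i : ℕ) ∈ Finset.Ico ((c - 2 * n) / 2) ((c + 1) / 2) ∪
    {φ.length * (2 * n) + (c - 1) / (4 * n)}

/-- The interval of chain rows has at most `n + 1` members, the extra one arising when `c` is odd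
and cuts through a group; one clause row is added. -/
theorem card_crossingRows_le {n : ℕ} (φ : CNFFormula n) (c : ℕ) :
    (crossingRows φ c).card ≤ n + 2 := by
  have h₁ : (crossingRows φ c).card ≤ (Finset.Ico ((c - 2 * n) / 2) ((c + 1) / 2) ∪
      {φ.length * (2 * n) + (c - 1) / (4 * n)}).card :=
    Finset.card_le_card_of_injOn (fun i => (i : ℕ)) (fun i hi => (Finset.mem_filter.1 hi).2)
      Fin.val_injective.injOn
  refine h₁.trans ((Finset.card_union_le _ _).trans ?_)
  rw [Nat.card_Ico, Finset.card_singleton]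
  omega

theorem chainEntry_ne_zero {n g j : ℕ} (h : chainEntry n g j ≠ 0) :
    j / 2 = g ∨ j / 2 = g + n := by
  unfold chainEntry at h
  exact (ite_ne_right_iff.1 h).1

theorem clauseEntry_ne_zero {n : ℕ} {φ : CNFFormula n} {k j : ℕ} (h : clauseEntry φ k j ≠ 0) :
    4 * n * k < j ∧ j < 4 * n * (k + 1) := by
  unfold clauseEntry at h
  obtain ⟨⟨h₁, h₂, h₃⟩, -⟩ := ite_ne_right_iff.1 h
  obtain ⟨l, -, hl⟩ := (getD_clauseMask _ _).1 h₃
  have := litPos_lt l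
  have e₁ : 4 * n * k = 2 * (k * (2 * n)) := by ring
  have e₂ : 4 * n * (k + 1) = 2 * (k * (2 * n)) + 4 * n := by ring
  omega

/-- The nonzero entries of chain row `g` lie between the columns `2 * g` and `2 * (g + n) + 1`, and
those of clause row `k` in an interval of length `4 * n`. The latter intervals are disjoint. -/
theorem mem_crossingRows {n : ℕ} (φ : CNFFormula n) (c : ℕ) (i : Fin (satInstance φ).m) {j j' : ℕ}
    (hj : j < c) (hj' : c ≤ j') (h : satEntry φ i j ≠ 0) (h' : satEntry φ i j' ≠ 0) :
    i ∈ crossingRows φ c := by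
  refine Finset.mem_filter.2 ⟨Finset.mem_univ _, ?_⟩
  unfold satEntry at h h'
  rw [Finset.mem_union, Finset.mem_Ico, Finset.mem_singleton]
  split_ifs at h h' with hi
  · have h₁ := chainEntry_ne_zero h
    have h₂ := chainEntry_ne_zero h'
    left
    omega
  · have h₁ := clauseEntry_ne_zero h
    have h₂ := clauseEntry_ne_zero h'
    right
    -- Because `j ≤ c - 1 < j'`, column `c - 1` lies in the interval of this clause and determines
    -- its number.
    have : (c - 1) / (4 * n) = i - φ.length * (2 * n) :=
      Nat.div_eq_of_lt_le (by rw [Nat.mul_comm]; omega) (by rw [Nat.mul_comm]; omega)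
    omega

theorem pathWidth_satInstance_le {n : ℕ} (φ : CNFFormula n) (hn : 0 < n) :
    (satInstance φ).pathWidth ≤ n + 3 := by
  refine Matroid.pathWidth_le_of_connectivity_le ?_ _ rfl (by omega) fun c => ?_
  · change 2 ≤ 2 * (φ.length * (2 * n) + n)
    omega
  refine (Matrix.connectivity_columnMatroid_le _ _ (crossingRows φ c) fun i hi => ?_).trans
    (Nat.add_le_add_right (card_crossingRows_le φ c) 1)
  by_contra! hcon
  obtain ⟨⟨j, hj, hij⟩, ⟨j', hj', hij'⟩⟩ := hcon
  refine hi (mem_crossingRows φ c i (j := j) (j' := j') hj (not_lt.1 hj') ?_ ?_)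
  · intro h0
    exact hij (by
      change (((satEntry φ i j : ℕ)) : ℝ) = 0
      rw [h0, Nat.cast_zero])
  · intro h0
    exact hij' (by
      change (((satEntry φ i j' : ℕ)) : ℝ) = 0
      rw [h0, Nat.cast_zero])

theorem pathWidth_satInstance_zero (φ : CNFFormula 0) : (satInstance φ).pathWidth ≤ 3 := by
  unfold IPInstance.pathWidth Matroid.pathWidth
  set S := {w : ℕ | ∃ D : ((satInstance φ).A.map (fun x : ℕ => (x : ℝ))).columnMatroid.BranchDecomposition,
    D.IsCaterpillar ∧ D.WidthLE w}
  -- There are no columns. Without any decomposition the infimum is `0`; otherwise every cut of a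
  -- given one has connectivity at most `1`, as no row has an entry.
  rcases S.eq_empty_or_nonempty with h | ⟨w, D, hD, -⟩
  · rw [h, Nat.sInf_empty]
    omega
  · refine Nat.sInf_le ⟨D, hD, fun u v _ => ?_⟩
    refine (Matrix.connectivity_columnMatroid_le _ _ ∅ fun i _ => .inl fun j _ => ?_).trans
      (by simp)
    have hj : (j : ℕ) < 2 * (φ.length * (2 * 0) + 0) := j.2
    omega

theorem pathWidth_satInstance {n : ℕ} (φ : CNFFormula n) : (satInstance φ).pathWidth ≤ n + 3 := by
  rcases Nat.eq_zero_or_pos n with rfl | hn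
  · exact pathWidth_satInstance_zero φ
  · exact pathWidth_satInstance_le φ hn

end StackProg

/-! ### Running time estimates and the conclusion -/

theorem DecidesWithin.mono {M : Turing.TM2ComputableAux Computability.Γ' Bool}
    {w : List Computability.Γ'} {P : Prop} {t t' : ℝ} (h : DecidesWithin M w P t) (ht : t ≤ t') :
    DecidesWithin M w P t' := by
  obtain ⟨s, hs, h⟩ := h
  exact ⟨s, hs.trans ht, h⟩

/-- The inequality `x ≤ s⁻¹ * exp (s * x)` at `x = n + 1` is raised to the power `b`, with `s` so
small that `s * b ≤ δ * log 2`. Dividing by `b + 1` in `s` covers `b = 0`; the factor `2 ^ δ` comes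
from `n + 1` in place of `n`. -/
theorem exists_succ_pow_le_mul_two_rpow (b : ℕ) {δ : ℝ} (hδ : 0 < δ) :
    ∃ K : ℝ, 0 < K ∧ ∀ n : ℕ, ((n : ℝ) + 1) ^ b ≤ K * (2 : ℝ) ^ (δ * n) := by
  have hlog : 0 < Real.log 2 := Real.log_pos one_lt_two
  set s := δ * Real.log 2 / (b + 1) with hs
  have hb : (0 : ℝ) < b + 1 := by positivity
  have hs0 : 0 < s := by positivity
  refine ⟨(s⁻¹) ^ b * (2 : ℝ) ^ δ, by positivity, fun n => ?_⟩
  have h₁ : (n : ℝ) + 1 ≤ s⁻¹ * Real.exp (s * (n + 1)) := by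
    rw [inv_mul_eq_div, le_div_iff₀ hs0]
    have := Real.add_one_le_exp (s * ((n : ℝ) + 1))
    nlinarith
  have h₂ : Real.exp (s * (n + 1)) ^ b ≤ (2 : ℝ) ^ (δ * (n + 1)) := by
    rw [← Real.exp_nat_mul, Real.rpow_def_of_pos two_pos, Real.exp_le_exp]
    have e : s * (b + 1) = δ * Real.log 2 := div_mul_cancel₀ _ hb.ne'
    have hn : (0 : ℝ) ≤ s * (n + 1) := by positivity
    have : Real.log 2 * (δ * (n + 1)) = s * (b + 1) * (n + 1) := by rw [e]; ring
    rw [this]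
    nlinarith
  calc ((n : ℝ) + 1) ^ b ≤ (s⁻¹ * Real.exp (s * (n + 1))) ^ b := by gcongr
    _ = (s⁻¹) ^ b * Real.exp (s * (n + 1)) ^ b := mul_pow _ _ _
    _ ≤ (s⁻¹) ^ b * (2 : ℝ) ^ (δ * (n + 1)) := by gcongr
    _ = (s⁻¹) ^ b * (2 : ℝ) ^ δ * (2 : ℝ) ^ (δ * n) := by
      rw [mul_assoc, ← Real.rpow_add two_pos]
      congr 2
      ring

namespace StackProg

/-- For `X = (n + 1) * (m + 1)` the numbers `n` and `m` are at most `X` and the number of chain rows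
is at most `2 * X`, which leaves a cubic polynomial in `X`. -/
theorem reductionTime_le (q n m : ℕ) :
    reductionTime q n m ≤ 5000 * (q + 1) * ((n + 1) * (m + 1)) ^ 3 := by
  set X := (n + 1) * (m + 1) with hX
  have hn : n + 1 ≤ X := Nat.le_mul_of_pos_right _ (Nat.succ_pos m)
  have hn' : n ≤ X := by omega
  have hm : m ≤ X := by nlinarith
  have hd : m * (2 * n) ≤ 2 * X := by nlinarith
  have hX1 : 1 ≤ X := by omega
  have h₂ : n + 2 ≤ 2 * X := by omega
  have key : reductionTime q n m ≤
      7 * X ^ 2 + (2 * X + 1) + (5 * (X * (q * (2 * X) + 2)) + 2) + (X * (X * 6 + 2 + 4) + 2) +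
      80 * (2 * X + X + X + 1) ^ 2 + (2 * X * (7 * (X + 2 * X) + 24) + 4) +
      (X * (q * (7 * X ^ 2 + 15 * X + 7) + 33 * X + 7 * (2 * X) + 21) + 1) +
      (4 * (2 * X) + 4 * X + 6) + (2 * X + 1) := by
    unfold reductionTime
    gcongr
  refine key.trans ?_
  have a₀ : 1 ≤ X ^ 3 := Nat.one_le_pow _ _ hX1
  have a₁ : X ≤ X ^ 3 := Nat.le_self_pow (by norm_num) X
  have a₂ : X ^ 2 ≤ X ^ 3 := Nat.pow_le_pow_right hX1 (by norm_num)
  have b₁ := Nat.mul_le_mul_left q a₁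
  have b₂ := Nat.mul_le_mul_left q a₂
  have b₃ := Nat.zero_le (q * X ^ 3)
  nlinarith

theorem length_encodeNumber_le (x : ℕ) : (encodeNumber x).length ≤ x + 1 := by
  have := length_encodeNat_le x
  simp only [encodeNumber, List.length_append, List.length_map, List.length_cons, List.length_nil]
  omega

theorem length_flatMap_range_le {β : Type*} (N B : ℕ) (f : ℕ → List β)
    (hf : ∀ i, (f i).length ≤ B) : ((List.range N).flatMap f).length ≤ N * B := by
  induction N with
  | zero => simp
  | succ N ih =>
    rw [List.range_succ, List.flatMap_append, List.length_append, List.flatMap_singleton,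
      Nat.succ_mul]
    exact Nat.add_le_add ih (hf N)

theorem satEntry_le {n : ℕ} (φ : CNFFormula n) (i j : ℕ) : satEntry φ i j ≤ 1 := by
  unfold satEntry chainEntry clauseEntry
  split_ifs <;> omega

theorem size_satInstance_le {n : ℕ} (φ : CNFFormula n) :
    (satInstance φ).size ≤ 40 * ((n + 1) * (φ.length + 1)) ^ 2 := by
  set m := φ.length with hm
  set X := (n + 1) * (m + 1) with hX
  have hX1 : 1 ≤ X := Nat.mul_pos (Nat.succ_pos n) (Nat.succ_pos m)
  have hrows : m * (2 * n) + m ≤ 2 * X := by nlinarith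
  have hcols : 2 * (m * (2 * n) + n) ≤ 4 * X := by nlinarith
  have hrow : ∀ i, ([Computability.Γ'.bra] ++ (List.range (2 * (m * (2 * n) + n))).flatMap
      (fun j => encodeNumber (satEntry φ i j)) ++ [Computability.Γ'.ket]).length ≤ 8 * X + 2 := by
    intro i
    have := length_flatMap_range_le (2 * (m * (2 * n) + n)) 2
      (fun j => encodeNumber (satEntry φ i j)) fun j =>
        (length_encodeNumber_le _).trans (Nat.add_le_add_right (satEntry_le φ i j) 1)
    simp only [List.length_append, List.length_cons, List.length_nil]
    omega
  have h₁ := length_flatMap_range_le (m * (2 * n) + m) (8 * X + 2) _ hrow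
  have h₂ := length_flatMap_range_le (m * (2 * n) + m) 2 (fun _ => encodeNumber 1) fun _ => le_rfl
  have h₃ := length_encodeNumber_le (m * (2 * n) + m)
  have h₄ := length_encodeNumber_le (2 * (m * (2 * n) + n))
  have h₅ := Nat.mul_le_mul_right (8 * X + 2) hrows
  have e : (satInstance φ).size = _ :=
    congrArg List.length (encode_mk _ _ (satEntry φ) fun _ => 1)
  rw [e]
  simp only [List.length_append, List.length_cons, List.length_nil, ← hm] at h₁ h₂ ⊢
  nlinarith

/-- Only the values `f 0` and `f 1` occur, and absolute values remove any condition on their signs.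
The factor `8 = 2 ^ 3` pays for the `3` in the bound `n + 3` on the path-width. Passing from `ε` to
`η ≤ 1` makes the exponent monotone in the path-width. -/
theorem ipTime_satInstance_le {n : ℕ} (φ : CNFFormula n) (f : ℕ → ℝ) {ε η : ℝ} (hη0 : 0 < η)
    (hη1 : η ≤ 1) (hηε : η ≤ ε) (a : ℕ) :
    f (satInstance φ).maxTarget * (((satInstance φ).maxTarget : ℝ) + 1) ^
      ((1 - ε) * ((satInstance φ).pathWidth : ℝ)) * ((satInstance φ).size : ℝ) ^ a ≤
    (|f 0| + |f 1|) * (8 * (2 : ℝ) ^ ((1 - η) * n)) * ((satInstance φ).size : ℝ) ^ a := by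
  set E : ℝ := (2 : ℝ) ^ ((1 - η) * n) with hE
  have hE1 : 1 ≤ E := Real.one_le_rpow one_le_two (mul_nonneg (by linarith) (Nat.cast_nonneg n))
  have h8E : (2 : ℝ) ^ ((1 - η) * ((n : ℝ) + 3)) ≤ 8 * E := by
    have : (2 : ℝ) ^ ((1 - η) * 3) ≤ 8 := by
      calc (2 : ℝ) ^ ((1 - η) * 3) ≤ (2 : ℝ) ^ (3 : ℝ) :=
            Real.rpow_le_rpow_of_exponent_le one_le_two (by linarith)
        _ = 8 := by norm_num
    rw [mul_add, Real.rpow_add two_pos, mul_comm]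
    exact mul_le_mul_of_nonneg_right this (by positivity)
  refine mul_le_mul_of_nonneg_right ?_ (by positivity)
  have h₀ : f 0 ≤ |f 0| + |f 1| := (le_abs_self _).trans (le_add_of_nonneg_right (abs_nonneg _))
  have h₁ : f 1 ≤ |f 0| + |f 1| := (le_abs_self _).trans (le_add_of_nonneg_left (abs_nonneg _))
  have hF : 0 ≤ |f 0| + |f 1| := by positivity
  -- Without clauses there are no rows, so `d = 0` and the power is `1`.
  rcases Nat.eq_zero_or_pos φ.length with h0 | h0
  · rw [maxTarget_satInstance_nil φ h0, Nat.cast_zero, zero_add, Real.one_rpow, mul_one]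
    exact h₀.trans (le_mul_of_one_le_right hF (by linarith))
  · rw [maxTarget_satInstance φ h0.ne', Nat.cast_one, one_add_one_eq_two]
    have h₂ : (2 : ℝ) ^ ((1 - ε) * ((satInstance φ).pathWidth : ℝ)) ≤ 8 * E := by
      refine le_trans (Real.rpow_le_rpow_of_exponent_le one_le_two ?_) h8E
      have hpw : ((satInstance φ).pathWidth : ℝ) ≤ (n : ℝ) + 3 := by
        exact_mod_cast pathWidth_satInstance φ
      exact mul_le_mul (by linarith) hpw (Nat.cast_nonneg _) (by linarith)
    exact mul_le_mul h₁ h₂ (by positivity) hF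

theorem totalTime_le {T S F Q X E : ℝ} (a : ℕ) (hF : 0 ≤ F) (hQ : 0 ≤ Q) (hX : 1 ≤ X) (hE : 1 ≤ E)
    (hS0 : 0 ≤ S) (hT : T ≤ Q * X ^ 3) (hS : S ≤ 40 * X ^ 2) :
    T + (S + 1) + F * (8 * E) * S ^ a ≤
      (Q + 41 + F * 8 * 40 ^ a) * (E * X ^ (2 * a + 3)) := by
  have hX0 : 0 ≤ X := zero_le_one.trans hX
  have hE0 : 0 ≤ E := zero_le_one.trans hE
  have hX3 : X ^ 3 ≤ E * X ^ (2 * a + 3) :=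
    (pow_le_pow_right₀ hX (by omega)).trans (le_mul_of_one_le_left (by positivity) hE)
  have hX2 : X ^ 2 ≤ E * X ^ (2 * a + 3) := (pow_le_pow_right₀ hX (by norm_num)).trans hX3
  have hX1 : 1 ≤ E * X ^ (2 * a + 3) := (one_le_pow₀ hX).trans hX3
  have hSa : S ^ a ≤ 40 ^ a * X ^ (2 * a + 3) := by
    calc S ^ a ≤ (40 * X ^ 2) ^ a := pow_le_pow_left₀ hS0 hS a
      _ = 40 ^ a * X ^ (2 * a) := by rw [mul_pow, ← pow_mul]
      _ ≤ 40 ^ a * X ^ (2 * a + 3) :=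
        mul_le_mul_of_nonneg_left (pow_le_pow_right₀ hX (by omega)) (by positivity)
  have h₁ : F * (8 * E) * S ^ a ≤ F * (8 * E) * (40 ^ a * X ^ (2 * a + 3)) :=
    mul_le_mul_of_nonneg_left hSa (by positivity)
  have h₂ : Q * X ^ 3 ≤ Q * (E * X ^ (2 * a + 3)) := mul_le_mul_of_nonneg_left hX3 hQ
  have h₃ : (Q + 41 + F * 8 * 40 ^ a) * (E * X ^ (2 * a + 3)) = Q * (E * X ^ (2 * a + 3)) +
      41 * (E * X ^ (2 * a + 3)) + F * (8 * E) * (40 ^ a * X ^ (2 * a + 3)) := by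
    ring
  rw [h₃]
  linarith

theorem decidesWithin_reduction (M : Turing.TM2ComputableAux Computability.Γ' Bool) {n : ℕ}
    (φ : CNFFormula n) {q : ℕ} (hφ : φ.IsWidthLE q) {s : ℝ}
    (hM : DecidesWithin M (satInstance φ).encode (satInstance φ).Feasible s) :
    DecidesWithin (precompose reduction .inp .out M) φ.encode φ.Satisfiable
      ((reductionTime q n φ.length : ℝ) + ((satInstance φ).size + 1) + s) := by
  obtain ⟨t, ht, hexec⟩ := runs_reduction φ q hφ
  have hin : St.get ⟨φ.encode, [], [], [], [], [], [], [], [], [], [], []⟩ =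
      Function.update (fun _ => []) Stk.inp φ.encode := by
    funext k
    cases k <;> rfl
  have hout : St.get ⟨[], (reductionCode φ).reverse, [], [], [], [], [], [], [], [], [], []⟩ =
      Function.update (fun _ => []) Stk.out (reductionCode φ).reverse := by
    funext k
    cases k <;> rfl
  rw [hin, hout] at hexec
  rw [IPInstance.size]
  rw [encode_satInstance, propext (feasible_satInstance φ)] at *
  have ht' : (t : ℝ) ≤ reductionTime q n φ.length := by exact_mod_cast ht
  exact (decidesWithin_precompose M hexec hM).mono (by linarith)

/-- Half of the gain `η` absorbs the polynomial factor in `n`: the exponents `1 - η` and `η / 2` add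
up to `1 - η / 2`. Only the multiplicative constant depends on `q`, not the exponent. -/
theorem qSatSolvable_of_ipSolvable {f : ℕ → ℝ} {ε : ℝ} (hε : 0 < ε) {a : ℕ}
    (h : IPSolvableInTime (fun P =>
      f P.maxTarget * ((P.maxTarget : ℝ) + 1) ^ ((1 - ε) * (P.pathWidth : ℝ)) *
        (P.size : ℝ) ^ a)) (q : ℕ) {c : ℝ≥0} (hc : (c : ℝ) = 1 - min ε 1 / 2) :
    QSatSolvableWithExponent q c := by
  obtain ⟨M, hM⟩ := h
  set η := min ε 1 with hη
  have hη0 : 0 < η := lt_min hε one_pos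
  have hη1 : η ≤ 1 := min_le_right _ _
  obtain ⟨K₀, hK₀, hK⟩ := exists_succ_pow_le_mul_two_rpow (2 * a + 3) (half_pos hη0)
  set C : ℝ := 5000 * (q + 1) + 41 + (|f 0| + |f 1|) * 8 * 40 ^ a with hC
  have hC0 : 0 ≤ C := by positivity
  refine ⟨precompose reduction .inp .out M, ⌈C * K₀⌉₊, 2 * a + 3, fun n φ hφ => ?_⟩
  refine (decidesWithin_reduction M φ hφ (hM (satInstance φ))).mono ?_
  have hX : (1 : ℝ) ≤ ((n : ℝ) + 1) * ((φ.length : ℝ) + 1) :=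
    one_le_mul_of_one_le_of_one_le (by simp) (by simp)
  have hE : (1 : ℝ) ≤ (2 : ℝ) ^ ((1 - η) * n) :=
    Real.one_le_rpow one_le_two (mul_nonneg (by linarith) (Nat.cast_nonneg n))
  have hT : (reductionTime q n φ.length : ℝ) ≤
      5000 * (q + 1) * (((n : ℝ) + 1) * ((φ.length : ℝ) + 1)) ^ 3 := by
    exact_mod_cast reductionTime_le q n φ.length
  have hS : ((satInstance φ).size : ℝ) ≤ 40 * (((n : ℝ) + 1) * ((φ.length : ℝ) + 1)) ^ 2 := by
    exact_mod_cast size_satInstance_le φ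
  have hbound := totalTime_le a (F := |f 0| + |f 1|) (by positivity) (by positivity) hX hE
    (Nat.cast_nonneg _) hT hS
  have hip := ipTime_satInstance_le φ f hη0 hη1 (min_le_left ε 1) a
  have hY : (0 : ℝ) ≤ ((φ.length : ℝ) + 1) ^ (2 * a + 3) := by positivity
  have hCE : 0 ≤ C * (2 : ℝ) ^ ((1 - η) * n) := by positivity
  calc _ ≤ C * ((2 : ℝ) ^ ((1 - η) * n) *
        (((n : ℝ) + 1) * ((φ.length : ℝ) + 1)) ^ (2 * a + 3)) :=
        (add_le_add_right hip _).trans hbound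
    _ = C * (2 : ℝ) ^ ((1 - η) * n) * ((n : ℝ) + 1) ^ (2 * a + 3) *
        ((φ.length : ℝ) + 1) ^ (2 * a + 3) := by
        rw [mul_pow]; ring
    _ ≤ C * (2 : ℝ) ^ ((1 - η) * n) * (K₀ * (2 : ℝ) ^ (η / 2 * n)) *
        ((φ.length : ℝ) + 1) ^ (2 * a + 3) :=
        mul_le_mul_of_nonneg_right (mul_le_mul_of_nonneg_left (hK n) hCE) hY
    _ = C * K₀ * (2 : ℝ) ^ ((c : ℝ) * n) * ((φ.length : ℝ) + 1) ^ (2 * a + 3) := by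
        rw [hc, show (1 - η / 2) * (n : ℝ) = (1 - η) * n + η / 2 * n by ring,
          Real.rpow_add two_pos]
        ring
    _ ≤ _ := mul_le_mul_of_nonneg_right
        (mul_le_mul_of_nonneg_right (Nat.le_ceil _) (by positivity)) hY

end StackProg

theorem theorem4 (hSETH : SETH) (f : ℕ → ℝ) (ε : ℝ) (hε : 0 < ε) (a : ℕ) :
    ¬ IPSolvableInTime (fun P =>
      f P.maxTarget * ((P.maxTarget : ℝ) + 1) ^ ((1 - ε) * (P.pathWidth : ℝ)) *
        (P.size : ℝ) ^ a) := by
  intro h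
  have hη0 : 0 < min ε 1 := lt_min hε one_pos
  have hη1 : min ε 1 ≤ 1 := min_le_right _ _
  -- The minimum with `1` keeps the exponent non-negative; it stays below `1` and is the same for
  -- all `q`, so it bounds the limit of the `δ_q`.
  set c : ℝ≥0 := ⟨1 - min ε 1 / 2, by linarith⟩ with hc
  have hle : ∀ q, satExponent q ≤ (c : ℝ≥0∞) := fun q =>
    iInf₂_le c (StackProg.qSatSolvable_of_ipSolvable hε h q rfl)
  have h1 : (1 : ℝ≥0∞) ≤ (c : ℝ≥0∞) := le_of_tendsto' hSETH hle
  have h2 : (1 : ℝ) ≤ (c : ℝ) := by exact_mod_cast h1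
  have h3 : (c : ℝ) = 1 - min ε 1 / 2 := rfl
  linarith
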